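/- Let $n\ge 0$ be an integer and $m\in\mathbb R$; all functions and distributions are real-valued, $\mathcal S=\mathcal S(\mathbb R^n,\mathbb R)$. **Brackets and star products of fields at equal time.** A Hamiltonian function is a smooth function $f(u_\alpha,\xi_\beta)$ of finitely many of the variables $u_\alpha,\xi_\beta$, $\alpha,\beta\in\mathbb N^n$; for $\varphi,\pi\in\mathcal S$ its density is $f(\partial^\alpha\varphi(x),\partial^\beta\pi(x))$. Put $\partial_{u,x}=\sum_\alpha\frac{\partial}{\partial u_\alpha}\partial_x^\alpha$, $\partial_{\xi,x}=\sum_\beta\frac{\partial}{\partial \xi_\beta}\partial_x^\beta$, where $\partial_x^\alpha$ acts only on the distribution factor $\delta(x-y)$, and likewise $\partial_{v,y},\partial_{\eta,y}$. For Hamiltonian functions $f(u,\xi)$, $g(v,\eta)$ assigned to the points $x$, $y$, $$\{f,g\}_\delta=(\partial_{u,x}\partial_{\eta,y}-\partial_{\xi,x}\partial_{v,y})\big(f\,g\,\delta(x-y)\big),\qquad f\star_\delta g=fg+\sum_{k\ge1}\frac{\hbar^k}{k!}(\partial_{u,x}\partial_{\eta,y}-\partial_{\xi,x}\partial_{v,y})^k\big(f\,g\,\delta(x-y)\big),$$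 evaluated at $u_\alpha=\partial^\alpha\varphi(x)$, $\xi_\beta=\partial^\beta\pi(x)$, $v_\alpha=\partial^\alpha\varphi(y)$, $\eta_\beta=\partial^\beta\pi(y)$. These are, for each $y$, a tempered distribution in $x$, respectively a formal power series in $\hbar$ with such coefficients. In particular $\{\pi(x),\varphi(y)\}_\delta=-\delta(x-y)$ and $\{\varphi(x),\varphi(y)\}_\delta=0$. **Klein–Gordon equation.** There is exactly one curve $t\mapsto\Delta(t,\cdot)$ of tempered distributions on $\mathbb R^n$, twice weakly differentiable in $t$, with $$(\partial_t^2-\triangle_x+m^2)\Delta=0,\qquad \Delta(0,\cdot)=0,\qquad \partial_t\Delta(0,\cdot)=\delta .$$ Convolution with $\Delta(t,\cdot)$ and with $\partial_t\Delta(t,\cdot)$ maps $\mathcal S$ continuously to $\mathcal S$, so that both can be convolved with any tempered distribution. For all $\varphi,\pi\in\mathcal S$ the Cauchy problem $(\partial_t^2-\triangle_x+m^2)\phi=0$, $\phi(0,x)=\varphi(x)$, $\phi_t(0,x)=\pi(x)$ has a solution $t\mapsto\phi(t,\cdot)$, twice differentiable as a curve in $\mathcal S$, and every such solution is given by $\phi(t,\cdot)=\Delta(t,\cdot)*\pi+\partial_t\Delta(t,\cdot)*\varphi$.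 **Bracket.** For $s,t\in\mathbb R$ extend the bracket from the Cauchy data $(\phi(s,\cdot),\phi_t(s,\cdot))$ at time $s$ by (convolution in the variable $x$) $$\{\phi(t,x),\phi(s,y)\}:=\Delta(t-s,\cdot)*\{\phi_t(s,x),\phi(s,y)\}_\delta+\partial_t\Delta(t-s,\cdot)*\{\phi(s,x),\phi(s,y)\}_\delta .$$ Then for all $s,t\in\mathbb R$ and $y\in\mathbb R^n$, as distributions in $x$, $$\{\phi(t,x),\phi(s,y)\}=-\Delta(t-s,x-y);$$ for $s=0$ this reads $\{\phi(t,x),\varphi(y)\}=-\Delta(t,x-y)$. The same distribution is obtained by extending the bracket $\{\cdot,\cdot\}_\delta$ of the initial data $(\varphi,\pi)$ at time $0$ bilinearly, by convolution in $x$ and in $y$, to $\phi(t,\cdot)=\Delta(t,\cdot)*\pi+\partial_t\Delta(t,\cdot)*\varphi$ and $\phi(s,\cdot)=\Delta(s,\cdot)*\pi+\partial_t\Delta(s,\cdot)*\varphi$. **Star product.** Define the star product, a formal power series in $\hbar$ whose coefficients are distributions in $x$ for each $y$, by $$\phi(t,x)\star\phi(s,y):=\Delta(t-s,\cdot)*\big(\phi_t(s,x)\star_\delta\phi(s,y)\big)+\partial_t\Delta(t-s,\cdot)*\big(\phi(s,x)\star_\delta\phi(s,y)\big).$$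 Then for all $s,t\in\mathbb R$ and $y\in\mathbb R^n$ $$\phi(t,x)\star\phi(s,y)=\phi(t,x)\,\phi(s,y)+\hbar\,\{\phi(t,x),\phi(s,y)\}.$$ -/

import Mathlib

open scoped SchwartzMap Laplacian LineDeriv Topology ContDiff

noncomputable section

namespace Peierls

/-! ### Space, test functions, distributions -/

/-- The space `ℝⁿ`. -/
abbrev Space (n : ℕ) := EuclideanSpace ℝ (Fin n)

/-- Real valued Schwartz functions on `ℝⁿ`. -/
abbrev Test (n : ℕ) := 𝓢(Space n, ℝ)

/-- Real tempered distributions on `ℝⁿ`. -/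
abbrev Dist (n : ℕ) := Test n →L[ℝ] ℝ

/-- Multi-indices. -/
abbrev MultiIndex (n : ℕ) := Fin n →₀ ℕ

/-- The operator `∂^α` on Schwartz functions. -/
def mderiv {n : ℕ} (α : MultiIndex n) : Test n →L[ℝ] Test n :=
  ((List.finRange n).map fun i =>
    (LineDeriv.lineDerivOpCLM ℝ (Test n) (EuclideanSpace.single i (1 : ℝ))) ^ (α i)).prod

/-- `translate a χ` is the function `z ↦ χ (z + a)`. -/
def translate {n : ℕ} (a : Space n) : Test n →L[ℝ] Test n :=
  SchwartzMap.compSubConstCLM ℝ (-a)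

/-- `reflect χ` is the function `z ↦ χ (-z)`. -/
def reflect {n : ℕ} : Test n →L[ℝ] Test n :=
  SchwartzMap.compCLMOfContinuousLinearEquiv ℝ (ContinuousLinearEquiv.neg ℝ)

/-- The Dirac distribution at `y`, that is `δ(x - y)` as a distribution in `x`. -/
def dirac {n : ℕ} (y : Space n) : Dist n :=
  (BoundedContinuousFunction.evalCLM ℝ y).comp
    (SchwartzMap.toBoundedContinuousFunctionCLM ℝ (Space n) ℝ)

/-- The distribution `χ ↦ ∫ c(x) χ(x) dx` given by a function `c` of temperate growth. -/
def ofFunction {n : ℕ} (c : Space n → ℝ) : Dist n :=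
  (SchwartzMap.integralCLM ℝ MeasureTheory.volume).comp (SchwartzMap.smulLeftCLM ℝ c)

/-- For a distribution `F(x)`, the distribution `F(x - y)` in the variable `x`:
`⟨F(x - y), χ(x)⟩ = ⟨F(z), χ(z + y)⟩`. -/
def shift {n : ℕ} (F : Dist n) (y : Space n) : Dist n := F.comp (translate y)

/-! ### Convolution

A distribution in `(x, y)` is given as a family `y ↦ B y` of distributions in `x`, which is
possible for all the kernels that occur (they depend smoothly on the parameter `y`). -/

/-- The convolution `(F ∗ φ)(x) = ⟨F(z), φ(x - z)⟩` of a distribution and a Schwartz function. -/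
def convFun {n : ℕ} (F : Dist n) (φ : Test n) (x : Space n) : ℝ :=
  F (reflect (translate x φ))

/-- `T` is the transpose of convolution by `F`: `(T χ)(x) = ⟨F(z), χ(x + z)⟩`. -/
def IsConvTranspose {n : ℕ} (F : Dist n) (T : Test n →L[ℝ] Test n) : Prop :=
  ∀ (χ : Test n) (x : Space n), T χ x = F (translate x χ)

/-- `F` can be convolved with every tempered distribution. -/
def IsConvolutor {n : ℕ} (F : Dist n) : Prop := ∃ T, IsConvTranspose F T

open scoped Classical in
/-- The convolution `F ∗ B`, `⟨F ∗ B, χ⟩ = ⟨B(x), ⟨F(z), χ(x + z)⟩⟩`, of a convolutor `F` and a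
tempered distribution `B` (by convention it is zero if `F` is not a convolutor). -/
def conv {n : ℕ} (F B : Dist n) : Dist n :=
  if h : IsConvolutor F then B.comp h.choose else 0

/-- `C` is the convolution by `F` in the parameter `y` of the kernel `B`:
`⟨C y, χ⟩ = ⟨F(z), ⟨B (y - z), χ⟩⟩`, the inner pairing being a Schwartz function of `z`. -/
def IsConvParam {n : ℕ} (F : Dist n) (B C : Space n → Dist n) : Prop :=
  ∀ (y : Space n) (χ : Test n), ∃ ψ : Test n, (∀ z, ψ z = B (y - z) χ) ∧ C y χ = F ψ

open scoped Classical in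
/-- The convolution `F ∗ B` in the parameter `y` of the kernel `B` (by convention it is zero if it
does not exist). -/
def convParam {n : ℕ} (F : Dist n) (B : Space n → Dist n) : Space n → Dist n :=
  if h : ∃ C, IsConvParam F B C then h.choose else 0

/-! ### Hamiltonian functions, Poisson bracket and star product -/

/-- Values of the variables `u_α` (`Sum.inl α`) and `ξ_β` (`Sum.inr β`). -/
abbrev Jet (n : ℕ) := MultiIndex n ⊕ MultiIndex n → ℝ

/-- Hamiltonian functions: smooth functions of finitely many of the variables `u_α`, `ξ_β`. -/
structure HamFun (n : ℕ) where
  toFun : Jet n → ℝ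
  smooth' : ∃ (S : Finset (MultiIndex n ⊕ MultiIndex n)) (g : (S → ℝ) → ℝ),
    ContDiff ℝ ∞ g ∧ ∀ j, toFun j = g fun i => j i

/-- A coordinate as a Hamiltonian function. -/
def HamFun.coord {n : ℕ} (i : MultiIndex n ⊕ MultiIndex n) : HamFun n where
  toFun j := j i
  smooth' := ⟨{i}, fun v => v ⟨i, Finset.mem_singleton_self i⟩, by fun_prop, fun _ => rfl⟩

/-- The Hamiltonian function `u_0`; its density is the field `φ(x)` itself. -/
def HamFun.phi {n : ℕ} : HamFun n := HamFun.coord (Sum.inl 0)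

/-- The Hamiltonian function `ξ_0`; its density is the conjugate field `π(x)` itself. -/
def HamFun.pi {n : ℕ} : HamFun n := HamFun.coord (Sum.inr 0)

/-- Functions of two groups of variables, `(u, ξ)` assigned to `x` and `(v, η)` assigned to `y`. -/
abbrev Coeff (n : ℕ) := Jet n → Jet n → ℝ

/-- Partial derivative in a variable of the first group. -/
def Coeff.d₁ {n : ℕ} (i : MultiIndex n ⊕ MultiIndex n) (F : Coeff n) : Coeff n :=
  fun j k => deriv (fun s => F (Function.update j i s) k) (j i)

/-- Partial derivative in a variable of the second group. -/
def Coeff.d₂ {n : ℕ} (i : MultiIndex n ⊕ MultiIndex n) (F : Coeff n) : Coeff n :=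
  fun j k => deriv (fun s => F j (Function.update k i s)) (k i)

/-- Formal sums `∑ K (γ, σ) ∂_x^γ ∂_y^σ δ(x - y)` with coefficients that are functions of the
variables `(u, ξ)` and `(v, η)`. -/
abbrev FormalKernel (n : ℕ) := MultiIndex n × MultiIndex n → Coeff n

/-- The formal kernel `f(u, ξ) g(v, η) δ(x - y)`. -/
def FormalKernel.mulDelta {n : ℕ} (f g : HamFun n) : FormalKernel n :=
  fun p j k => if p = 0 then f.toFun j * g.toFun k else 0

/-- The operator `∂_{u,x} ∂_{η,y} - ∂_{ξ,x} ∂_{v,y}` where `∂_{u,x} = ∑_α ∂/∂u_α ∂_x^α` and so on;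
the derivatives `∂_x^α`, `∂_y^β` act on the distribution factor, `∂/∂u_α` etc. on the
coefficient. -/
def FormalKernel.poissonOp {n : ℕ} (K : FormalKernel n) : FormalKernel n := fun p j k =>
  ∑ a ∈ Finset.HasAntidiagonal.antidiagonal p.1, ∑ b ∈ Finset.HasAntidiagonal.antidiagonal p.2,
    (Coeff.d₁ (Sum.inl a.1) (Coeff.d₂ (Sum.inr b.1) (K (a.2, b.2))) j k -
      Coeff.d₁ (Sum.inr a.1) (Coeff.d₂ (Sum.inl b.1) (K (a.2, b.2))) j k)

/-- The values at `x` of all derivatives of a pair of fields `(φ, π)`. -/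
def jet {n : ℕ} (φ π : Test n) (x : Space n) : Jet n :=
  Sum.elim (fun α => mderiv α φ x) (fun β => mderiv β π x)

/-- `∂_x^γ ∂_y^σ δ(x - y)` as a distribution in `x`: since `∂_y δ(x - y) = - ∂_x δ(x - y)`, its
value at `χ` is `(-1)^{|γ|} (∂^{γ+σ} χ)(y)`. -/
def deltaDeriv {n : ℕ} (p : MultiIndex n × MultiIndex n) (y : Space n) : Dist n :=
  ((-1 : ℝ) ^ p.1.degree) • (dirac y).comp (mderiv (p.1 + p.2))

/-- Substitution of the fields `(φ, π)` at `x` and at `y` in a formal kernel. -/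
def FormalKernel.eval {n : ℕ} (K : FormalKernel n) (φ π : Test n) (y : Space n) : Dist n :=
  ∑ᶠ p, (deltaDeriv p y).comp
    (SchwartzMap.smulLeftCLM ℝ fun x => K p (jet φ π x) (jet φ π y))

/-- The Poisson bracket `{f(∂φ(x), ∂π(x)), g(∂φ(y), ∂π(y))}_δ` of two Hamiltonian densities, a
distribution in `x` depending on `y`. -/
def bracketDelta {n : ℕ} (f g : HamFun n) (φ π : Test n) (y : Space n) : Dist n :=
  (FormalKernel.mulDelta f g).poissonOp.eval φ π y

/-- The star product `f(∂φ(x), ∂π(x)) ⋆_δ g(∂φ(y), ∂π(y))` of two Hamiltonian densities, a formal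
power series in `ħ` given as the sequence of its coefficients: the coefficient of `ħ^0` is the
product, the one of `ħ^k`, `k ≥ 1`, is
`(1/k!) (∂_{u,x} ∂_{η,y} - ∂_{ξ,x} ∂_{v,y})^k (f g δ(x - y))`. -/
def starDelta {n : ℕ} (f g : HamFun n) (φ π : Test n) (y : Space n) : ℕ → Dist n
  | 0 => ofFunction fun x => f.toFun (jet φ π x) * g.toFun (jet φ π y)
  | k + 1 => ((k + 1).factorial : ℝ)⁻¹ •
      (FormalKernel.poissonOp^[k + 1] (FormalKernel.mulDelta f g)).eval φ π y

/-! ### The Klein–Gordon equation -/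

/-- The Klein–Gordon equation `∂_t² u - Δ u + m² u = 0` for a curve `u` of Schwartz functions,
differentiable in the Schwartz space, with time derivative `v`. -/
structure IsKleinGordon {n : ℕ} (m : ℝ) (u v : ℝ → Test n) : Prop where
  velocity : ∀ t, HasDerivAt u (v t) t
  equation : ∀ t, HasDerivAt v (Δ (u t) - m ^ 2 • u t) t

/-- The Cauchy problem with initial data `(φ, π)` at time `0`. -/
structure IsCauchySolution {n : ℕ} (m : ℝ) (φ π : Test n) (u v : ℝ → Test n) : Prop
    extends IsKleinGordon m u v where
  init : u 0 = φ
  init_velocity : v 0 = π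

/-- `G` is the Green function: the distributional solution of the Klein–Gordon equation with
`G(0) = 0`, `∂_t G(0) = δ`. Here `G'` is its time derivative `∂_t G`. -/
structure IsGreenFunction {n : ℕ} (m : ℝ) (G G' : ℝ → Dist n) : Prop where
  velocity : ∀ t χ, HasDerivAt (fun τ => G τ χ) (G' t χ) t
  equation : ∀ t χ, HasDerivAt (fun τ => G' τ χ) (G t (Δ χ - m ^ 2 • χ)) t
  init : G 0 = 0
  init_velocity : G' 0 = dirac 0

/-! ### Bracket and star product of the space-time fields

`G`, `G'` are the Green function and its time derivative; `u t` is the field `φ(t, ·)` and `v t` its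
time derivative. -/

/-- The bracket `{φ(t,x), φ(s,y)}` by extension from the Cauchy data at time `s`:
`G(t-s) ∗ {φ_t(s,x), φ(s,y)}_δ + ∂_t G(t-s) ∗ {φ(s,x), φ(s,y)}_δ`. -/
def bracket {n : ℕ} (G G' : ℝ → Dist n) (u v : ℝ → Test n) (t s : ℝ) (y : Space n) : Dist n :=
  conv (G (t - s)) (bracketDelta HamFun.pi HamFun.phi (u s) (v s) y) +
    conv (G' (t - s)) (bracketDelta HamFun.phi HamFun.phi (u s) (v s) y)

/-- The bracket `{φ(t,x), φ(s,y)}` by bilinear extension, in both arguments, from the Cauchy data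
`(φ, π)` at time `0`, by `φ(t,·) = G(t) ∗ π + ∂_t G(t) ∗ φ` and
`φ(s,·) = G(s) ∗ π + ∂_t G(s) ∗ φ`. -/
def bracketInitial {n : ℕ} (G G' : ℝ → Dist n) (φ π : Test n) (t s : ℝ) (y : Space n) :
    Dist n :=
  convParam (G s) (fun w => conv (G t) (bracketDelta HamFun.pi HamFun.pi φ π w)) y +
    convParam (G' s) (fun w => conv (G t) (bracketDelta HamFun.pi HamFun.phi φ π w)) y +
    convParam (G s) (fun w => conv (G' t) (bracketDelta HamFun.phi HamFun.pi φ π w)) y +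
    convParam (G' s) (fun w => conv (G' t) (bracketDelta HamFun.phi HamFun.phi φ π w)) y

/-- The star product `φ(t,x) ⋆ φ(s,y)`, a formal power series in `ħ`:
`G(t-s) ∗ (φ_t(s,x) ⋆_δ φ(s,y)) + ∂_t G(t-s) ∗ (φ(s,x) ⋆_δ φ(s,y))`. -/
def star {n : ℕ} (G G' : ℝ → Dist n) (u v : ℝ → Test n) (t s : ℝ) (y : Space n) : ℕ → Dist n :=
  fun k =>
    conv (G (t - s)) (starDelta HamFun.pi HamFun.phi (u s) (v s) y k) +
      conv (G' (t - s)) (starDelta HamFun.phi HamFun.phi (u s) (v s) y k)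

end Peierls

end

/-!
The operator `-Δ + m²` acts on Fourier transforms as multiplication by `r ξ = 4π²‖ξ‖² + m² ≥ 0`.
Since `sin √ρ / √ρ` and `cos √ρ` are entire functions of `ρ` whose derivatives are all bounded on
`[0, ∞)`, the multipliers `sin (t √r) / √r` and `cos (t √r)` have temperate growth jointly in
`(t, ξ)`. The propagators they define are therefore differentiable curves of operators on the
Schwartz space, and composing them with `δ` gives the Green function and its time derivative.

Uniqueness, for distributions as well as for Schwartz functions, comes from duality. If `D` is a
weakly differentiable curve of distributions and `u` a curve of Schwartz functions, both solving
the Klein–Gordon equation, then `⟨D (c - t), ∂ₜ u t⟩ + ⟨∂ₜ D (c - t), u t⟩` does not depend on `t`.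
To differentiate this pairing one needs joint continuity of `(t, χ) ↦ D t χ`, which is the
Banach–Steinhaus theorem in the Fréchet space of Schwartz functions.

The bracket of two coordinates has constant coefficients, so that all powers of `ħ` beyond the
first vanish in their star product, and the bilinear extension of the bracket from time `0` reduces
to the addition theorem for the sine.
-/

noncomputable section

namespace Peierls

open Filter (Tendsto)

/-! ### Differentiable curves in topological vector spaces -/

section Curves

variable {F F' : Type*} [AddCommGroup F] [Module ℝ F] [TopologicalSpace F] [ContinuousSMul ℝ F]
  [AddCommGroup F'] [Module ℝ F'] [TopologicalSpace F'] [ContinuousSMul ℝ F']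

theorem hasDerivAt_iff_tendsto_inv_smul {u : ℝ → F} {v : F} {t : ℝ} :
    HasDerivAt u v t ↔ Tendsto (fun h : ℝ => h⁻¹ • (u (t + h) - u t - h • v)) (𝓝 0) (𝓝 0) := by
  have hmap : 𝓝 t = Filter.map (fun h => t + h) (𝓝 0) := by rw [map_add_left_nhds, add_zero]
  rw [hasDerivAt_iff_hasFDerivAt, hasFDerivAt_iff_isLittleOTVS,
    Asymptotics.isLittleOTVS_iff_tendsto_inv_smul, hmap, Filter.tendsto_map'_iff]
  · simp [Function.comp_def]
  · refine Filter.Eventually.of_forall fun x hx => ?_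
    simp [sub_eq_zero.1 hx]

theorem hasDerivAt_clm_comp (L : F →L[ℝ] F') {u : ℝ → F} {v : F} {t : ℝ}
    (hu : HasDerivAt u v t) : HasDerivAt (fun τ => L (u τ)) (L v) t := by
  rw [hasDerivAt_iff_tendsto_inv_smul] at hu ⊢
  simpa [Function.comp_def] using (L.continuous.tendsto 0).comp hu

theorem hasDerivAt_curve_add [IsTopologicalAddGroup F] {u₁ u₂ : ℝ → F} {v₁ v₂ : F} {t : ℝ}
    (h₁ : HasDerivAt u₁ v₁ t) (h₂ : HasDerivAt u₂ v₂ t) :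
    HasDerivAt (fun τ => u₁ τ + u₂ τ) (v₁ + v₂) t := by
  rw [hasDerivAt_iff_tendsto_inv_smul] at h₁ h₂ ⊢
  refine (add_zero (0 : F) ▸ h₁.add h₂).congr fun h => ?_
  module

end Curves

section BarrelledPairing

variable {F G : Type*} [AddCommGroup F] [Module ℝ F] [UniformSpace F] [IsUniformAddGroup F]
  [ContinuousSMul ℝ F] [BarrelledSpace ℝ F] [NormedAddCommGroup G] [NormedSpace ℝ G]

theorem continuous_uncurry_of_barrelled {X : Type*} [TopologicalSpace X]
    [WeaklyLocallyCompactSpace X] {D : X → F →L[ℝ] G} (hD : ∀ χ, Continuous fun x => D x χ) :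
    Continuous fun p : X × F => D p.1 p.2 := by
  rw [continuous_iff_continuousAt]
  rintro ⟨x, χ⟩
  obtain ⟨K, hK, hKx⟩ := exists_compact_mem_nhds x
  have hequi : UniformEquicontinuous ((↑) ∘ fun y : K => D y : K → F → G) := by
    refine (norm_withSeminorms ℝ G).banach_steinhaus fun _ ψ => ?_
    refine (hK.image (hD ψ).norm).bddAbove.mono ?_
    rintro _ ⟨y, rfl⟩
    exact ⟨y, y.2, rfl⟩
  rw [ContinuousAt, Metric.tendsto_nhds]
  intro ε hε
  have hχ := Metric.equicontinuousAt_iff_right.1 (hequi.equicontinuous χ) (ε / 2) (half_pos hε)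
  have hx := Metric.tendsto_nhds.1 ((hD χ).tendsto x) (ε / 2) (half_pos hε)
  rw [nhds_prod_eq]
  filter_upwards [(hx.and hKx).prod_mk hχ] with p hp
  calc dist (D p.1 p.2) (D x χ) ≤ dist (D p.1 p.2) (D p.1 χ) + dist (D p.1 χ) (D x χ) :=
        dist_triangle _ _ _
    _ < ε / 2 + ε / 2 := add_lt_add (dist_comm (D p.1 χ) _ ▸ hp.2 ⟨p.1, hp.1.2⟩) hp.1.1
    _ = ε := add_halves ε

theorem hasDerivAt_apply_of_barrelled {D : ℝ → F →L[ℝ] G} {D' : ℝ → F → G} {w : ℝ → F} {w' : F}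
    {t : ℝ} (hD : ∀ τ χ, HasDerivAt (fun τ => D τ χ) (D' τ χ) τ) (hw : HasDerivAt w w' t) :
    HasDerivAt (fun τ => D τ (w τ)) (D' t (w t) + D t w') t := by
  have hcont : ∀ χ, Continuous fun τ => D τ χ := fun χ =>
    continuous_iff_continuousAt.2 fun τ => (hD τ χ).continuousAt
  have hadd : Tendsto (fun h => t + h) (𝓝 0) (𝓝 t) := by
    simpa using (continuous_const_add t).tendsto 0
  have hDt := hasDerivAt_iff_tendsto_inv_smul.1 (hD t (w t))
  rw [hasDerivAt_iff_tendsto_inv_smul] at hw ⊢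
  have hremainder : Tendsto (fun h : ℝ => D (t + h) (h⁻¹ • (w (t + h) - w t - h • w')))
      (𝓝 0) (𝓝 0) := by
    simpa only [map_zero, Function.comp_def] using
      ((continuous_uncurry_of_barrelled hcont).tendsto (t, 0)).comp (hadd.prodMk_nhds hw)
  have hvary : Tendsto (fun h : ℝ => D (t + h) w' - D t w') (𝓝 0) (𝓝 0) := by
    simpa using (((hcont w').tendsto t).comp hadd).sub_const (D t w')
  have hsum := (hremainder.add hvary).add hDt
  simp only [add_zero] at hsum
  refine hsum.congr fun h => ?_
  rcases eq_or_ne h 0 with rfl | hh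
  · simp
  · simp only [map_smul, map_sub]
    match_scalars <;> field_simp <;> ring

end BarrelledPairing

/-! ### Completeness of the Schwartz space -/

section Completeness

variable {E F : Type*} [NormedAddCommGroup E] [NormedSpace ℝ E]
  [NormedAddCommGroup F] [NormedSpace ℝ F]

theorem hasFTaylorSeriesUpTo_of_tendstoUniformly {u : ℕ → E → F} (hu : ∀ n, ContDiff ℝ ∞ (u n))
    {p : E → FormalMultilinearSeries ℝ E F}
    (hp : ∀ l, TendstoUniformly (fun n x => iteratedFDeriv ℝ l (u n) x) (fun x => p x l)
      Filter.atTop) :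
    HasFTaylorSeriesUpTo ∞ (fun x => (p x 0).curry0) p := by
  have hderiv (l : ℕ) (x : E) : HasFDerivAt (fun y => p y l) (p x l.succ).curryLeft x := by
    refine hasFDerivAt_of_tendstoUniformly
      ((continuousMultilinearCurryLeftEquiv ℝ (fun _ : Fin (l + 1) => E)
        F).isometry.uniformContinuous.comp_tendstoUniformly (hp (l + 1)))
      (f := fun n y => iteratedFDeriv ℝ l (u n) y) (fun n y => ?_)
      (fun y => (hp l).tendsto_at y) x
    exact (contDiff_iff_ftaylorSeries.1 (hu n)).fderiv l
      (by exact_mod_cast ENat.natCast_lt_top l) y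
  exact ⟨fun _ => rfl, fun l _ x => hderiv l x, fun l _ =>
    continuous_iff_continuousAt.2 fun x => (hderiv l x).continuousAt⟩

theorem exists_seminorm_sub_lt {u : ℕ → 𝓢(E, F)} (hu : CauchySeq u) (k l : ℕ) {ε : ℝ}
    (hε : 0 < ε) : ∃ N, ∀ m ≥ N, ∀ n ≥ N, SchwartzMap.seminorm ℝ k l (u m - u n) < ε := by
  have hdiff := cauchySeq_iff_tendsto.1 hu
  rw [uniformity_eq_comap_nhds_zero, Filter.tendsto_comap_iff] at hdiff
  have hcont : Continuous (SchwartzMap.seminorm ℝ k l : 𝓢(E, F) → ℝ) :=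
    (schwartz_withSeminorms ℝ E F).continuous_seminorm (k, l)
  have hlim := (hcont.tendsto 0).comp hdiff
  rw [map_zero] at hlim
  obtain ⟨N, hN⟩ := Filter.eventually_atTop.1 (hlim.eventually (gt_mem_nhds hε))
  exact ⟨max N.1 N.2, fun m hm n hn => hN (n, m)
    ⟨(le_max_left _ _).trans hn, (le_max_right _ _).trans hm⟩⟩

theorem iteratedFDeriv_schwartz_sub (f g : 𝓢(E, F)) (l : ℕ) (x : E) :
    iteratedFDeriv ℝ l (f - g : 𝓢(E, F)) x = iteratedFDeriv ℝ l f x - iteratedFDeriv ℝ l g x :=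
  iteratedFDeriv_sub_apply (f.smooth l).contDiffAt (g.smooth l).contDiffAt

theorem exists_iteratedFDeriv_limit [CompleteSpace F] {u : ℕ → 𝓢(E, F)} (hu : CauchySeq u) :
    ∃ p : E → FormalMultilinearSeries ℝ E F, ∀ k l : ℕ, ∀ ε > 0, ∃ N, ∀ n ≥ N, ∀ x : E,
      ‖x‖ ^ k * ‖iteratedFDeriv ℝ l (u n) x - p x l‖ ≤ ε := by
  have hseminorm (k l m n : ℕ) (x : E) :
      ‖x‖ ^ k * ‖iteratedFDeriv ℝ l (u m) x - iteratedFDeriv ℝ l (u n) x‖ ≤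
        SchwartzMap.seminorm ℝ k l (u m - u n) :=
    iteratedFDeriv_schwartz_sub (u m) (u n) l x ▸ SchwartzMap.le_seminorm ℝ k l (u m - u n) x
  have hlim (x : E) (l : ℕ) :
      ∃ a, Tendsto (fun m => iteratedFDeriv ℝ l (u m) x) Filter.atTop (𝓝 a) := by
    refine cauchySeq_tendsto_of_complete (Metric.cauchySeq_iff.2 fun ε hε => ?_)
    obtain ⟨N, hN⟩ := exists_seminorm_sub_lt hu 0 l hε
    refine ⟨N, fun m hm n hn => lt_of_le_of_lt ?_ (hN m hm n hn)⟩
    simpa [dist_eq_norm] using hseminorm 0 l m n x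
  choose p hp using hlim
  refine ⟨p, fun k l ε hε => ?_⟩
  obtain ⟨N, hN⟩ := exists_seminorm_sub_lt hu k l hε
  refine ⟨N, fun n hn x => le_of_tendsto (((hp x l).const_sub _).norm.const_mul (‖x‖ ^ k)) ?_⟩
  filter_upwards [Filter.eventually_ge_atTop N] with m hm
  exact (hseminorm k l n m x).trans (hN n hn m hm).le

theorem exists_schwartzMap_of_iteratedFDeriv_limit {u : ℕ → 𝓢(E, F)}
    {p : E → FormalMultilinearSeries ℝ E F} (hp : ∀ k l : ℕ, ∀ ε > 0, ∃ N, ∀ n ≥ N, ∀ x : E,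
      ‖x‖ ^ k * ‖iteratedFDeriv ℝ l (u n) x - p x l‖ ≤ ε) :
    ∃ f : 𝓢(E, F), ∀ l x, iteratedFDeriv ℝ l f x = p x l := by
  have hunif (l : ℕ) : TendstoUniformly (fun n x => iteratedFDeriv ℝ l (u n) x)
      (fun x => p x l) Filter.atTop := by
    refine Metric.tendstoUniformly_iff.2 fun ε hε => ?_
    obtain ⟨N, hN⟩ := hp 0 l (ε / 2) (half_pos hε)
    filter_upwards [Filter.eventually_ge_atTop N] with n hn x
    rw [dist_comm, dist_eq_norm]
    exact lt_of_le_of_lt (by simpa using hN n hn x) (half_lt_self hε)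
  have htaylor := hasFTaylorSeriesUpTo_of_tendstoUniformly (fun n => (u n).smooth ⊤) hunif
  have hiter (l : ℕ) (x : E) : iteratedFDeriv ℝ l (fun x => (p x 0).curry0) x = p x l :=
    (htaylor.eq_iteratedFDeriv (by exact_mod_cast le_top) x).symm
  refine ⟨⟨fun x => (p x 0).curry0, htaylor.contDiff, fun k l => ?_⟩, hiter⟩
  obtain ⟨N, hN⟩ := hp k l 1 one_pos
  refine ⟨SchwartzMap.seminorm ℝ k l (u N) + 1, fun x => ?_⟩
  calc ‖x‖ ^ k * ‖iteratedFDeriv ℝ l (fun x => (p x 0).curry0) x‖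
      ≤ ‖x‖ ^ k * (‖iteratedFDeriv ℝ l (u N) x‖ + ‖iteratedFDeriv ℝ l (u N) x - p x l‖) := by
        rw [hiter]
        gcongr
        exact norm_le_norm_add_norm_sub _ _
    _ ≤ SchwartzMap.seminorm ℝ k l (u N) + 1 := by
        rw [mul_add]
        exact add_le_add (SchwartzMap.le_seminorm ℝ k l (u N) x) (hN N le_rfl x)

instance instCompleteSpaceSchwartz [CompleteSpace F] : CompleteSpace 𝓢(E, F) := by
  have : (uniformity 𝓢(E, F)).IsCountablyGenerated :=
    IsUniformAddGroup.uniformity_countably_generated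
  refine UniformSpace.complete_of_cauchySeq_tendsto fun u hu => ?_
  obtain ⟨p, hp⟩ := exists_iteratedFDeriv_limit hu
  obtain ⟨f, hf⟩ := exists_schwartzMap_of_iteratedFDeriv_limit hp
  refine ⟨f, ((schwartz_withSeminorms ℝ E F).tendsto_nhds_atTop u f).2 fun ⟨k, l⟩ ε hε => ?_⟩
  obtain ⟨N, hN⟩ := hp k l (ε / 2) (half_pos hε)
  refine ⟨N, fun n hn => lt_of_le_of_lt ?_ (half_lt_self hε)⟩
  refine SchwartzMap.seminorm_le_bound ℝ k l _ (half_pos hε).le fun x => ?_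
  rw [iteratedFDeriv_schwartz_sub, hf]
  exact hN n hn x

instance instBarrelledSpaceSchwartz [CompleteSpace F] : BarrelledSpace ℝ 𝓢(E, F) := by
  have : (uniformity 𝓢(E, F)).IsCountablyGenerated :=
    IsUniformAddGroup.uniformity_countably_generated
  infer_instance

end Completeness

/-! ### Entire functions interpolating `sin √ρ / √ρ` and `cos √ρ` -/

section SincSqrt

/-- The power series `∑ (-1) ^ k / (2 k + 1)! ρ ^ k` of `sin √ρ / √ρ`. -/
def sincSqrtSeries : FormalMultilinearSeries ℝ ℝ ℝ :=
  FormalMultilinearSeries.ofScalars ℝ fun k => (-1 : ℝ) ^ k / (2 * k + 1).factorial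

/-- The entire function `ρ ↦ sin √ρ / √ρ`. -/
def sincSqrt : ℝ → ℝ := sincSqrtSeries.sum

/-- The entire function `ρ ↦ cos √ρ`. The formula is the derivative of `sincSqrt (x ^ 2) * x`,
which is `sin x`, with respect to `x`, expressed through `ρ = x ^ 2`. -/
def cosSqrt (ρ : ℝ) : ℝ := sincSqrt ρ + 2 * ρ * deriv sincSqrt ρ

theorem radius_sincSqrtSeries : sincSqrtSeries.radius = ⊤ := by
  refine FormalMultilinearSeries.radius_eq_top_of_summable_norm _ fun r => ?_
  refine (Real.summable_pow_div_factorial (r : ℝ)).of_nonneg_of_le (fun k => by positivity)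
    fun k => ?_
  have hfactorial : (k.factorial : ℝ) ≤ (2 * k + 1).factorial := by
    exact_mod_cast Nat.factorial_le (by omega)
  calc ‖sincSqrtSeries k‖ * (r : ℝ) ^ k = (r : ℝ) ^ k / (2 * k + 1).factorial := by
        simp [sincSqrtSeries, div_eq_inv_mul]
    _ ≤ (r : ℝ) ^ k / k.factorial := by gcongr

theorem contDiff_sincSqrt {k : WithTop ℕ∞} : ContDiff ℝ k sincSqrt := by
  have hball := sincSqrtSeries.hasFPowerSeriesOnBall (radius_sincSqrtSeries ▸ ENNReal.zero_lt_top)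
  have hanalytic := hball.analyticOnNhd
  rw [radius_sincSqrtSeries, Metric.eball_top] at hanalytic
  exact hanalytic.contDiff

theorem contDiff_cosSqrt {k : WithTop ℕ∞} : ContDiff ℝ k cosSqrt := by
  have hanalytic : AnalyticOnNhd ℝ (deriv sincSqrt) Set.univ :=
    (contDiff_sincSqrt (k := ω)).analyticOnNhd.deriv
  exact contDiff_sincSqrt.add ((contDiff_const.mul contDiff_id).mul hanalytic.contDiff)

theorem differentiable_sincSqrt : Differentiable ℝ sincSqrt :=
  (contDiff_sincSqrt (k := 1)).differentiable one_ne_zero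

theorem differentiable_cosSqrt : Differentiable ℝ cosSqrt :=
  (contDiff_cosSqrt (k := 1)).differentiable one_ne_zero

theorem sincSqrt_eq_tsum (ρ : ℝ) :
    sincSqrt ρ = ∑' k : ℕ, (-1 : ℝ) ^ k / (2 * k + 1).factorial * ρ ^ k :=
  FormalMultilinearSeries.ofScalars_sum_eq _ _

theorem sincSqrt_sq_mul_self (x : ℝ) : sincSqrt (x ^ 2) * x = Real.sin x := by
  rw [sincSqrt_eq_tsum, ← tsum_mul_right, ← (Real.hasSum_sin x).tsum_eq]
  exact tsum_congr fun k => by ring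

theorem hasDerivAt_mul_sincSqrt_sq_mul (a x : ℝ) :
    HasDerivAt (fun x => x * sincSqrt (x ^ 2 * a)) (cosSqrt (x ^ 2 * a)) x := by
  have hinner : HasDerivAt (fun x : ℝ => x ^ 2 * a) (2 * x * a) x := by
    simpa using (hasDerivAt_pow 2 x).mul_const a
  convert! (hasDerivAt_id x).mul ((differentiable_sincSqrt _).hasDerivAt.comp x hinner) using 1
  simp only [cosSqrt, id, Function.comp_apply]
  ring

theorem cosSqrt_sq (x : ℝ) : cosSqrt (x ^ 2) = Real.cos x := by
  refine HasDerivAt.unique (f := Real.sin) (x := x) ?_ (Real.hasDerivAt_sin x)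
  simpa [mul_comm _ (sincSqrt _), sincSqrt_sq_mul_self] using hasDerivAt_mul_sincSqrt_sq_mul 1 x

theorem cosSqrt_zero : cosSqrt 0 = 1 := by
  simpa using cosSqrt_sq 0

theorem deriv_cosSqrt : deriv cosSqrt = fun ρ => -(1 / 2) * sincSqrt ρ := by
  have hsq {x : ℝ} (hx : x ≠ 0) : deriv cosSqrt (x ^ 2) = -(1 / 2) * sincSqrt (x ^ 2) := by
    have hcos : HasDerivAt Real.cos (deriv cosSqrt (x ^ 2) * (2 * x)) x := by
      simpa [Function.comp_def, cosSqrt_sq] using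
        (differentiable_cosSqrt (x ^ 2)).hasDerivAt.comp x (hasDerivAt_pow 2 x)
    have heq := hcos.unique (Real.hasDerivAt_cos x)
    rw [← sincSqrt_sq_mul_self] at heq
    exact mul_right_cancel₀ hx (by linarith)
  refine AnalyticOnNhd.eq_of_eventuallyEq (z₀ := 1)
    (contDiff_cosSqrt (k := ω)).analyticOnNhd.deriv
    (contDiff_const.mul contDiff_sincSqrt).analyticOnNhd ?_
  filter_upwards [lt_mem_nhds one_pos] with ρ hρ
  simpa only [Real.sq_sqrt hρ.le] using hsq (Real.sqrt_ne_zero'.2 hρ)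

theorem hasDerivAt_cosSqrt (ρ : ℝ) : HasDerivAt cosSqrt (-(1 / 2) * sincSqrt ρ) ρ :=
  congrFun deriv_cosSqrt ρ ▸ (differentiable_cosSqrt ρ).hasDerivAt

theorem hasDerivAt_iteratedDeriv_of_contDiff {f : ℝ → ℝ} (hf : ContDiff ℝ ∞ f) (k : ℕ) (x : ℝ) :
    HasDerivAt (iteratedDeriv k f) (iteratedDeriv (k + 1) f x) x :=
  iteratedDeriv_succ (f := f) (n := k) ▸
    (hf.differentiable_iteratedDeriv k (by exact_mod_cast ENat.natCast_lt_top k) x).hasDerivAt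

theorem two_mul_iteratedDeriv_succ_sincSqrt (k : ℕ) (ρ : ℝ) :
    2 * ρ * iteratedDeriv (k + 1) sincSqrt ρ =
      iteratedDeriv k cosSqrt ρ - (2 * k + 1) * iteratedDeriv k sincSqrt ρ := by
  induction k generalizing ρ with
  | zero => simp [cosSqrt, iteratedDeriv_one]
  | succ k ih =>
    have hsinc := hasDerivAt_iteratedDeriv_of_contDiff contDiff_sincSqrt
    have hleft := ((hasDerivAt_id ρ).const_mul 2).mul (hsinc (k + 1) ρ)
    have hright := (hasDerivAt_iteratedDeriv_of_contDiff contDiff_cosSqrt k ρ).sub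
      ((hsinc k ρ).const_mul (2 * k + 1 : ℝ))
    have heq := hleft.unique (hright.congr_of_eventuallyEq (Filter.Eventually.of_forall ih))
    simp only [id, mul_one] at heq
    push_cast
    linarith

theorem iteratedDeriv_succ_cosSqrt (k : ℕ) (ρ : ℝ) :
    iteratedDeriv (k + 1) cosSqrt ρ = -(1 / 2) * iteratedDeriv k sincSqrt ρ := by
  rw [iteratedDeriv_succ', deriv_cosSqrt, iteratedDeriv_const_mul _ contDiff_sincSqrt.contDiffAt]

theorem hasDerivAt_pow_mul_iteratedDeriv_sincSqrt_sq (k : ℕ) (x : ℝ) :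
    HasDerivAt (fun x => x ^ (2 * k + 1) * iteratedDeriv k sincSqrt (x ^ 2))
      (x ^ (2 * k) * iteratedDeriv k cosSqrt (x ^ 2)) x := by
  have hinner := (hasDerivAt_iteratedDeriv_of_contDiff contDiff_sincSqrt k (x ^ 2)).comp x
    (hasDerivAt_pow 2 x)
  convert! (hasDerivAt_pow (2 * k + 1) x).mul hinner using 1
  have hrec := two_mul_iteratedDeriv_succ_sincSqrt k (x ^ 2)
  rw [eq_add_of_sub_eq hrec.symm]
  push_cast
  simp only [Function.comp_apply]
  ring

theorem abs_iteratedDeriv_sincSqrt_le {k : ℕ} {C : ℝ}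
    (hC : ∀ ρ, 0 ≤ ρ → |iteratedDeriv k cosSqrt ρ| ≤ C) {ρ : ℝ} (hρ : 0 ≤ ρ) :
    |iteratedDeriv k sincSqrt ρ| ≤ C := by
  rcases hρ.eq_or_lt with rfl | hρ
  · have hrec := two_mul_iteratedDeriv_succ_sincSqrt k 0
    rw [mul_zero, zero_mul, eq_comm, sub_eq_zero] at hrec
    refine le_trans ?_ (hC 0 le_rfl)
    rw [hrec, abs_mul]
    refine le_mul_of_one_le_left (abs_nonneg _) ?_
    rw [abs_of_nonneg (by positivity)]
    linarith [k.cast_nonneg (α := ℝ)]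
  · obtain ⟨x, hx, rfl⟩ : ∃ x : ℝ, 0 < x ∧ x ^ 2 = ρ :=
      ⟨√ρ, Real.sqrt_pos.2 hρ, Real.sq_sqrt hρ.le⟩
    -- `x ^ (2 * k + 1) * sincSqrt⁽ᵏ⁾ (x ^ 2)` is a primitive of `x ^ (2 * k) * cosSqrt⁽ᵏ⁾ (x ^ 2)`,
    -- so that a bound on `cosSqrt⁽ᵏ⁾` passes to `sincSqrt⁽ᵏ⁾` without loss.
    have hmvt := (convex_Icc 0 x).norm_image_sub_le_of_norm_hasDerivWithin_le
      (C := x ^ (2 * k) * C)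
      (fun y _ => (hasDerivAt_pow_mul_iteratedDeriv_sincSqrt_sq k y).hasDerivWithinAt)
      (fun y hy => ?_) (Set.left_mem_Icc.2 hx.le) (Set.right_mem_Icc.2 hx.le)
    · simp only [Real.norm_eq_abs, abs_mul, abs_pow, abs_of_pos hx, sub_zero, ne_eq,
        Nat.add_eq_zero_iff, one_ne_zero, and_false, not_false_eq_true, zero_pow, zero_mul] at hmvt
      refine le_of_mul_le_mul_left ?_ (pow_pos hx (2 * k + 1))
      exact hmvt.trans_eq (by ring)
    · rw [norm_mul, norm_pow, Real.norm_of_nonneg hy.1]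
      have hle := hC (y ^ 2) (sq_nonneg y)
      gcongr
      · exact hy.1
      · exact hy.2
      · exact hle

theorem abs_iteratedDeriv_cosSqrt_le_one (k : ℕ) {ρ : ℝ} (hρ : 0 ≤ ρ) :
    |iteratedDeriv k cosSqrt ρ| ≤ 1 := by
  induction k generalizing ρ with
  | zero =>
    rw [iteratedDeriv_zero, ← Real.sq_sqrt hρ, cosSqrt_sq]
    exact Real.abs_cos_le_one _
  | succ k ih =>
    rw [iteratedDeriv_succ_cosSqrt, abs_mul]
    have hsinc := abs_iteratedDeriv_sincSqrt_le (fun ρ hρ => ih hρ) hρ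
    norm_num
    linarith

theorem abs_iteratedDeriv_sincSqrt_le_one (k : ℕ) {ρ : ℝ} (hρ : 0 ≤ ρ) :
    |iteratedDeriv k sincSqrt ρ| ≤ 1 :=
  abs_iteratedDeriv_sincSqrt_le (fun _ => abs_iteratedDeriv_cosSqrt_le_one k) hρ

theorem hasTemperateGrowth_comp_of_nonneg {V : Type*} [NormedAddCommGroup V] [NormedSpace ℝ V]
    {g : ℝ → ℝ} (hg : ContDiff ℝ ∞ g)
    (hbound : ∀ k, ∃ C, ∀ ρ, 0 ≤ ρ → |iteratedDeriv k g ρ| ≤ C)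
    {f : V → ℝ} (hf : f.HasTemperateGrowth) (hpos : ∀ x, 0 ≤ f x) :
    Function.HasTemperateGrowth fun x => g (f x) := by
  choose C hC using hbound
  have hC0 (k : ℕ) : 0 ≤ C k := (abs_nonneg _).trans (hC k 0 le_rfl)
  refine Function.HasTemperateGrowth.comp' (t := Set.Ici 0) (Set.range_subset_iff.2 hpos)
    (uniqueDiffOn_Ici 0) hg.contDiffOn (fun N => ?_) hf
  refine ⟨0, ∑ k ∈ Finset.range (N + 1), C k, Finset.sum_nonneg fun k _ => hC0 k,
    fun k hk ρ hρ => ?_⟩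
  rw [iteratedFDerivWithin_eq_iteratedFDeriv (uniqueDiffOn_Ici 0)
    (hg.of_le (by exact_mod_cast le_top)).contDiffAt hρ,
    norm_iteratedFDeriv_eq_norm_iteratedDeriv, pow_zero, mul_one]
  exact (hC k ρ hρ).trans (Finset.single_le_sum (fun i _ => hC0 i)
    (Finset.mem_range.2 (Nat.lt_succ_of_le hk)))

theorem hasTemperateGrowth_sincSqrt_comp {V : Type*} [NormedAddCommGroup V] [NormedSpace ℝ V]
    {f : V → ℝ} (hf : f.HasTemperateGrowth) (hpos : ∀ x, 0 ≤ f x) :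
    Function.HasTemperateGrowth fun x => sincSqrt (f x) :=
  hasTemperateGrowth_comp_of_nonneg contDiff_sincSqrt
    (fun k => ⟨1, fun _ => abs_iteratedDeriv_sincSqrt_le_one k⟩) hf hpos

theorem hasTemperateGrowth_cosSqrt_comp {V : Type*} [NormedAddCommGroup V] [NormedSpace ℝ V]
    {f : V → ℝ} (hf : f.HasTemperateGrowth) (hpos : ∀ x, 0 ≤ f x) :
    Function.HasTemperateGrowth fun x => cosSqrt (f x) :=
  hasTemperateGrowth_comp_of_nonneg contDiff_cosSqrt
    (fun k => ⟨1, fun _ => abs_iteratedDeriv_cosSqrt_le_one k⟩) hf hpos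

end SincSqrt

/-! ### Multiplication by functions depending on a parameter -/

section ParameterMultiplier

variable {E V F : Type*} [NormedAddCommGroup E] [NormedSpace ℝ E] [NormedAddCommGroup V]
  [NormedSpace ℝ V] [NormedAddCommGroup F] [NormedSpace ℝ F]

theorem fderiv_iteratedFDeriv_apply {f : E → F} (hf : ContDiff ℝ ∞ f) (i : ℕ) (x w : E) :
    fderiv ℝ (iteratedFDeriv ℝ i f) x w = iteratedFDeriv ℝ i (fun y => fderiv ℝ f y w) x := by
  have hdiff (i : ℕ) : Differentiable ℝ (iteratedFDeriv ℝ i f) :=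
    hf.differentiable_iteratedFDeriv (by exact_mod_cast ENat.natCast_lt_top i)
  induction i generalizing x with
  | zero =>
    ext m
    rw [← fderiv_continuousMultilinear_apply_const_apply (hdiff 0 x)]
    simp only [iteratedFDeriv_zero_apply]
  | succ i ih =>
    ext m
    have hsmooth : ContDiff ℝ 2 (iteratedFDeriv ℝ i f) :=
      (contDiff_infty.1 hf (2 + i)).iteratedFDeriv_right (by norm_cast)
    have hsymm := (hsmooth.contDiffAt (x := x)).isSymmSndFDerivAt (by simp)
    have hdiff₂ : DifferentiableAt ℝ (fderiv ℝ (iteratedFDeriv ℝ i f)) x :=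
      (hsmooth.fderiv_right (m := 1) (by norm_num)).differentiable one_ne_zero x
    have hdir (v : E) := (hdiff₂.hasFDerivAt.clm_apply (hasFDerivAt_const v x))
    rw [← fderiv_continuousMultilinear_apply_const_apply (hdiff (i + 1) x),
      iteratedFDeriv_succ_apply_left, ← funext ih, (hdir w).fderiv]
    simp only [iteratedFDeriv_succ_apply_left]
    rw [fderiv_continuousMultilinear_apply_const_apply (hdir (m 0)).differentiableAt,
      (hdir (m 0)).fderiv]
    simp [hsymm.eq (m 0) w]

theorem hasTemperateGrowth_fderiv {f : E → F} (hf : f.HasTemperateGrowth) :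
    (fderiv ℝ f).HasTemperateGrowth := by
  refine ⟨hf.1.fderiv_right (by simp), fun i => ?_⟩
  obtain ⟨k, C, hC⟩ := hf.2 (i + 1)
  exact ⟨k, C, fun x => norm_iteratedFDeriv_fderiv (𝕜 := ℝ) (f := f) ▸ hC x⟩

theorem hasTemperateGrowth_fderiv_apply {f : E → F} (hf : f.HasTemperateGrowth) (w : E) :
    Function.HasTemperateGrowth fun x => fderiv ℝ f x w :=
  (ContinuousLinearMap.apply ℝ F w).hasTemperateGrowth.comp (hasTemperateGrowth_fderiv hf)

theorem iteratedFDeriv_slice {Φ : E × V → F} {i : ℕ} (hΦ : ContDiff ℝ i Φ) (t : E) (ξ : V) :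
    iteratedFDeriv ℝ i (fun ξ => Φ (t, ξ)) ξ =
      (iteratedFDeriv ℝ i Φ (t, ξ)).compContinuousLinearMap
        fun _ => ContinuousLinearMap.inr ℝ E V := by
  have hcomp := (ContinuousLinearMap.inr ℝ E V).iteratedFDeriv_comp_right
    (hΦ.comp (contDiff_const.add contDiff_id : ContDiff ℝ i fun z => (t, (0 : V)) + z)) ξ le_rfl
  rw [Function.comp_def Φ, iteratedFDeriv_comp_add_left] at hcomp
  simpa [Function.comp_def] using hcomp

theorem norm_compContinuousLinearMap_inr_le {i : ℕ}
    (M : ContinuousMultilinearMap ℝ (fun _ : Fin i => E × V) F) :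
    ‖M.compContinuousLinearMap fun _ => ContinuousLinearMap.inr ℝ E V‖ ≤ ‖M‖ :=
  (M.norm_compContinuousLinearMap_le _).trans <| mul_le_of_le_one_right (norm_nonneg M) <|
    Finset.prod_le_one (fun _ _ => norm_nonneg _)
      fun _ _ => ContinuousLinearMap.norm_inr_le_one ℝ E V

theorem hasTemperateGrowth_slice {Φ : E × V → F} (hΦ : Φ.HasTemperateGrowth) (t : E) :
    Function.HasTemperateGrowth fun ξ => Φ (t, ξ) := by
  refine hΦ.comp (f := fun ξ => (t, ξ)) ?_
  have hsplit : (fun ξ : V => (t, ξ)) =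
      (fun _ => (t, 0)) + ⇑(ContinuousLinearMap.inr ℝ E V) := by
    ext ξ <;> simp
  exact hsplit ▸ (Function.HasTemperateGrowth.const _).add
    (ContinuousLinearMap.inr ℝ E V).hasTemperateGrowth

theorem norm_iteratedFDeriv_prodMk_sub_le {Φ : ℝ × V → F} (hΦ : Φ.HasTemperateGrowth) (t : ℝ)
    (l : ℕ) : ∃ (K : ℕ) (C : ℝ), 0 ≤ C ∧ ∀ i ≤ l, ∀ s, |s - t| ≤ 1 → ∀ ξ,
      ‖iteratedFDeriv ℝ i Φ (s, ξ) - iteratedFDeriv ℝ i Φ (t, ξ)‖ ≤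
        C * (1 + ‖ξ‖) ^ K * |s - t| := by
  obtain ⟨K, C, hC, hbound⟩ := hΦ.norm_iteratedFDeriv_le_uniform (l + 1)
  refine ⟨K, C * (2 + |t|) ^ K, by positivity, fun i hi s hs ξ => ?_⟩
  have hmvt : ‖iteratedFDeriv ℝ i Φ (s, ξ) - iteratedFDeriv ℝ i Φ (t, ξ)‖ ≤
      C * ((2 + |t|) * (1 + ‖ξ‖)) ^ K * ‖(s, ξ) - (t, ξ)‖ := by
    refine Convex.norm_image_sub_le_of_norm_fderiv_le (𝕜 := ℝ)
      (s := Metric.closedBall t 1 ×ˢ {ξ}) (fun x _ => ?_) ?_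
      ((convex_closedBall t 1).prod (convex_singleton ξ)) (by simp)
      (by simpa [Real.dist_eq] using hs)
    · exact hΦ.1.differentiable_iteratedFDeriv (by exact_mod_cast ENat.natCast_lt_top i) x
    · rintro ⟨τ, η⟩ ⟨hτ, hη⟩
      obtain rfl : ξ = η := hη.symm
      rw [norm_fderiv_iteratedFDeriv]
      refine (hbound (i + 1) (by lia) _).trans ?_
      gcongr
      have hτt : |τ| ≤ 1 + |t| := by
        linarith [abs_sub_abs_le_abs_sub τ t, show |τ - t| ≤ 1 from hτ]
      have hnorm : ‖(τ, ξ)‖ ≤ 1 + |t| + ‖ξ‖ :=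
        max_le (by simpa using by linarith [norm_nonneg ξ]) (le_add_of_nonneg_left (by positivity))
      nlinarith [abs_nonneg t, norm_nonneg ξ]
  refine hmvt.trans_eq ?_
  simp only [Prod.mk_sub_mk, sub_self, Prod.norm_mk, norm_zero, Real.norm_eq_abs, abs_nonneg,
    sup_of_le_left, mul_pow]
  ring

theorem norm_iteratedFDeriv_slice_sub_le {Φ : ℝ × V → F} (hΦ : Φ.HasTemperateGrowth) (t : ℝ)
    (l : ℕ) : ∃ (K : ℕ) (C : ℝ), 0 ≤ C ∧ ∀ i ≤ l, ∀ s, |s - t| ≤ 1 → ∀ ξ,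
      ‖iteratedFDeriv ℝ i (fun ξ => Φ (s, ξ)) ξ - iteratedFDeriv ℝ i (fun ξ => Φ (t, ξ)) ξ‖ ≤
        C * (1 + ‖ξ‖) ^ K * |s - t| := by
  obtain ⟨K, C, hC, hbound⟩ := norm_iteratedFDeriv_prodMk_sub_le hΦ t l
  refine ⟨K, C, hC, fun i hi s hs ξ => le_trans ?_ (hbound i hi s hs ξ)⟩
  have hsmooth : ContDiff ℝ i Φ := hΦ.1.of_le (by exact_mod_cast le_top)
  rw [iteratedFDeriv_slice hsmooth, iteratedFDeriv_slice hsmooth]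
  exact norm_compContinuousLinearMap_inr_le
    (iteratedFDeriv ℝ i Φ (s, ξ) - iteratedFDeriv ℝ i Φ (t, ξ))

theorem hasDerivAt_iteratedFDeriv_slice {Φ : ℝ × V → F} (hΦ : ContDiff ℝ ∞ Φ) (i : ℕ) (t : ℝ)
    (ξ : V) : HasDerivAt (fun t => iteratedFDeriv ℝ i (fun ξ => Φ (t, ξ)) ξ)
      (iteratedFDeriv ℝ i (fun ξ => fderiv ℝ Φ (t, ξ) (1, 0)) ξ) t := by
  have hΦ' : ContDiff ℝ ∞ fun p => fderiv ℝ Φ p (1, 0) :=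
    (hΦ.fderiv_right (by simp)).clm_apply contDiff_const
  have hle : (i : WithTop ℕ∞) ≤ ∞ := by exact_mod_cast le_top
  have hline : HasDerivAt (fun t => (t, ξ)) (1, 0) t :=
    (hasDerivAt_id t).prodMk (hasDerivAt_const t ξ)
  have hΦt := ((hΦ.differentiable_iteratedFDeriv (by exact_mod_cast ENat.natCast_lt_top i)
    (t, ξ)).hasFDerivAt.comp_hasDerivAt t hline)
  rw [fderiv_iteratedFDeriv_apply hΦ] at hΦt
  simp only [iteratedFDeriv_slice (hΦ.of_le hle), iteratedFDeriv_slice (hΦ'.of_le hle)]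
  exact (ContinuousMultilinearMap.compContinuousLinearMapL (𝕜 := ℝ) (F := F)
    fun _ : Fin i => ContinuousLinearMap.inr ℝ ℝ V).hasFDerivAt.comp_hasDerivAt t hΦt

theorem exists_seminorm_smulLeftCLM_le (f : 𝓢(V, F)) (k l K : ℕ) :
    ∃ A, ∀ c : V → ℝ, c.HasTemperateGrowth → ∀ M, 0 ≤ M →
      (∀ i ≤ l, ∀ ξ, ‖iteratedFDeriv ℝ i c ξ‖ ≤ M * (1 + ‖ξ‖) ^ K) →
      SchwartzMap.seminorm ℝ k l (SchwartzMap.smulLeftCLM F c f) ≤ A * M := by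
  set B : ℝ := 2 ^ (K + k) *
    ((Finset.Iic (K + k, l)).sup fun m => SchwartzMap.seminorm ℝ m.1 m.2) f
  refine ⟨∑ i ∈ Finset.range (l + 1), (l.choose i : ℝ) * B, fun c hc M hM hbound => ?_⟩
  refine SchwartzMap.seminorm_le_bound ℝ k l _
    (mul_nonneg (Finset.sum_nonneg fun i _ => by positivity) hM) fun ξ => ?_
  have hfun : (SchwartzMap.smulLeftCLM F c f : V → F) = fun ξ => c ξ • f ξ :=
    funext fun ξ => SchwartzMap.smulLeftCLM_apply_apply hc f ξ
  have hterm (i : ℕ) (hi : i ∈ Finset.range (l + 1)) :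
      ‖ξ‖ ^ k * ((l.choose i : ℝ) * ‖iteratedFDeriv ℝ i c ξ‖ * ‖iteratedFDeriv ℝ (l - i) f ξ‖) ≤
        l.choose i * B * M := by
    have hdecay : (1 + ‖ξ‖) ^ (K + k) * ‖iteratedFDeriv ℝ (l - i) f ξ‖ ≤ B :=
      SchwartzMap.one_add_le_sup_seminorm_apply (𝕜 := ℝ) (m := (K + k, l)) le_rfl
        (Nat.sub_le _ _) f ξ
    have hle : ‖ξ‖ ≤ 1 + ‖ξ‖ := le_add_of_nonneg_left zero_le_one
    have hci := hbound i (Finset.mem_range_succ_iff.1 hi) ξ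
    calc _ ≤ (1 + ‖ξ‖) ^ k * ((l.choose i : ℝ) * (M * (1 + ‖ξ‖) ^ K) *
            ‖iteratedFDeriv ℝ (l - i) f ξ‖) := by gcongr
      _ = l.choose i * ((1 + ‖ξ‖) ^ (K + k) * ‖iteratedFDeriv ℝ (l - i) f ξ‖) * M := by ring
      _ ≤ l.choose i * B * M := by gcongr
  calc ‖ξ‖ ^ k * ‖iteratedFDeriv ℝ l (SchwartzMap.smulLeftCLM F c f) ξ‖
      ≤ ‖ξ‖ ^ k * ∑ i ∈ Finset.range (l + 1), (l.choose i : ℝ) *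
          ‖iteratedFDeriv ℝ i c ξ‖ * ‖iteratedFDeriv ℝ (l - i) f ξ‖ := by
        rw [hfun]
        gcongr
        exact norm_iteratedFDeriv_smul_le hc.1 (f.smooth ⊤) ξ (by exact_mod_cast le_top)
    _ ≤ (∑ i ∈ Finset.range (l + 1), (l.choose i : ℝ) * B) * M := by
        rw [Finset.mul_sum, Finset.sum_mul]
        exact Finset.sum_le_sum hterm

theorem norm_sub_sub_smul_le_of_lipschitz_deriv {W : Type*} [NormedAddCommGroup W]
    [NormedSpace ℝ W] {g g' : ℝ → W} {t h M : ℝ} (hM : 0 ≤ M)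
    (hg : ∀ s, HasDerivAt g (g' s) s)
    (hlip : ∀ s, |s - t| ≤ |h| → ‖g' s - g' t‖ ≤ M * |s - t|) :
    ‖g (t + h) - g t - h • g' t‖ ≤ M * h ^ 2 := by
  have hmvt : ‖(g (t + h) - (t + h) • g' t) - (g t - t • g' t)‖ ≤ M * |h| * ‖t + h - t‖ := by
    refine (convex_closedBall t |h|).norm_image_sub_le_of_norm_hasDerivWithin_le
      (f := fun s => g s - s • g' t) (f' := fun s => g' s - g' t)
      (fun s _ => ?_) (fun s hs => ?_) (by simp) (by simp)
    · refine ((hg s).sub ?_).hasDerivWithinAt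
      simpa using (hasDerivAt_id s).smul_const (g' t)
    · rw [Metric.mem_closedBall, Real.dist_eq] at hs
      exact (hlip s hs).trans (mul_le_mul_of_nonneg_left hs hM)
  calc ‖g (t + h) - g t - h • g' t‖
      = ‖(g (t + h) - (t + h) • g' t) - (g t - t • g' t)‖ := by congr 1; module
    _ ≤ M * |h| * ‖t + h - t‖ := hmvt
    _ = M * h ^ 2 := by
        rw [add_sub_cancel_left, Real.norm_eq_abs, ← sq_abs h]
        ring

theorem norm_iteratedFDeriv_slice_taylor_le {Φ : ℝ × V → F} (hΦ : Φ.HasTemperateGrowth) (t : ℝ)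
    (l : ℕ) : ∃ (K : ℕ) (C : ℝ), 0 ≤ C ∧ ∀ i ≤ l, ∀ h, |h| ≤ 1 → ∀ ξ,
      ‖iteratedFDeriv ℝ i (fun ξ => Φ (t + h, ξ) - Φ (t, ξ) - h • fderiv ℝ Φ (t, ξ) (1, 0)) ξ‖ ≤
        C * h ^ 2 * (1 + ‖ξ‖) ^ K := by
  have hΦ' := hasTemperateGrowth_fderiv_apply hΦ (1, 0)
  obtain ⟨K, C, hC, hlip⟩ := norm_iteratedFDeriv_slice_sub_le hΦ' t l
  refine ⟨K, C, hC, fun i hi h hh ξ => ?_⟩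
  set G : ℝ → ContinuousMultilinearMap ℝ (fun _ : Fin i => V) F :=
    fun s => iteratedFDeriv ℝ i (fun ξ => Φ (s, ξ)) ξ
  set G' : ℝ → ContinuousMultilinearMap ℝ (fun _ : Fin i => V) F :=
    fun s => iteratedFDeriv ℝ i (fun ξ => fderiv ℝ Φ (s, ξ) (1, 0)) ξ
  have hslice (s : ℝ) : ContDiffAt ℝ i (fun ξ => Φ (s, ξ)) ξ :=
    ((hasTemperateGrowth_slice hΦ s).1.of_le (by exact_mod_cast le_top)).contDiffAt
  have hslice' : ContDiffAt ℝ i (fun ξ => fderiv ℝ Φ (t, ξ) (1, 0)) ξ :=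
    ((hasTemperateGrowth_slice hΦ' t).1.of_le (by exact_mod_cast le_top)).contDiffAt
  have hG : iteratedFDeriv ℝ i
      (fun ξ => Φ (t + h, ξ) - Φ (t, ξ) - h • fderiv ℝ Φ (t, ξ) (1, 0)) ξ =
        G (t + h) - G t - h • G' t := by
    rw [fun_iteratedFDeriv_sub_apply ((hslice _).sub (hslice _)) (hslice'.const_smul h),
      fun_iteratedFDeriv_sub_apply (hslice _) (hslice _), iteratedFDeriv_const_smul_apply' hslice']
  have hremainder := norm_sub_sub_smul_le_of_lipschitz_deriv (g := G) (g' := G')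
    (mul_nonneg hC (by positivity)) (fun s => hasDerivAt_iteratedFDeriv_slice hΦ.1 i s ξ)
    fun s hs => hlip i hi s (hs.trans hh) ξ
  rw [hG]
  exact hremainder.trans_eq (by ring)

theorem hasDerivAt_smulLeftCLM_of_taylor {c : ℝ → V → ℝ} {c' : V → ℝ}
    (hc : ∀ s, (c s).HasTemperateGrowth) (hc' : c'.HasTemperateGrowth) {t : ℝ}
    (htaylor : ∀ l : ℕ, ∃ (K : ℕ) (C : ℝ), 0 ≤ C ∧ ∀ i ≤ l, ∀ h, |h| ≤ 1 → ∀ ξ,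
      ‖iteratedFDeriv ℝ i (fun ξ => c (t + h) ξ - c t ξ - h • c' ξ) ξ‖ ≤
        C * h ^ 2 * (1 + ‖ξ‖) ^ K) (f : 𝓢(V, F)) :
    HasDerivAt (fun s => SchwartzMap.smulLeftCLM F (c s) f) (SchwartzMap.smulLeftCLM F c' f) t := by
  have hR (h : ℝ) : Function.HasTemperateGrowth fun ξ => c (t + h) ξ - c t ξ - h • c' ξ :=
    ((hc _).sub (hc _)).sub ((Function.HasTemperateGrowth.const h).mul hc')
  have hremainder (h : ℝ) : SchwartzMap.smulLeftCLM F (c (t + h)) f -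
      SchwartzMap.smulLeftCLM F (c t) f - h • SchwartzMap.smulLeftCLM F c' f =
        SchwartzMap.smulLeftCLM F (fun ξ => c (t + h) ξ - c t ξ - h • c' ξ) f := by
    ext ξ
    simp only [sub_apply, smul_apply, SchwartzMap.smulLeftCLM_apply_apply (hR h),
      SchwartzMap.smulLeftCLM_apply_apply (hc _), SchwartzMap.smulLeftCLM_apply_apply hc']
    module
  rw [hasDerivAt_iff_tendsto_inv_smul]
  refine ((schwartz_withSeminorms ℝ V F).tendsto_nhds _ 0).2 fun ⟨k, l⟩ ε hε => ?_
  obtain ⟨K, C, hC, hbound⟩ := htaylor l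
  obtain ⟨A, hmul⟩ := exists_seminorm_smulLeftCLM_le f k l K
  have hsmall : Tendsto (fun h : ℝ => A * C * |h|) (𝓝 0) (𝓝 0) := by
    simpa using (continuous_abs.tendsto (0 : ℝ)).const_mul (A * C)
  filter_upwards [hsmall.eventually (gt_mem_nhds hε), Metric.closedBall_mem_nhds 0 one_pos]
    with h hlt hh
  rw [mem_closedBall_zero_iff, Real.norm_eq_abs] at hh
  refine lt_of_le_of_lt ?_ hlt
  rw [hremainder, sub_zero, map_smul_eq_mul, norm_inv, Real.norm_eq_abs]
  calc |h|⁻¹ * SchwartzMap.seminorm ℝ k l (SchwartzMap.smulLeftCLM F _ f)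
      ≤ |h|⁻¹ * (A * (C * h ^ 2)) := by
        gcongr
        exact hmul _ (hR h) _ (by positivity) fun i hi ξ => hbound i hi h hh ξ
    _ = A * C * |h| := by
        rw [← sq_abs h]
        rcases eq_or_ne |h| 0 with h0 | h0
        · simp [h0]
        · field_simp

theorem hasDerivAt_smulLeftCLM_slice {Φ Φ' : ℝ × V → ℝ} (hΦ : Φ.HasTemperateGrowth)
    (hderiv : ∀ t ξ, HasDerivAt (fun t => Φ (t, ξ)) (Φ' (t, ξ)) t) (f : 𝓢(V, F)) (t : ℝ) :
    HasDerivAt (fun t => SchwartzMap.smulLeftCLM F (fun ξ => Φ (t, ξ)) f)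
      (SchwartzMap.smulLeftCLM F (fun ξ => Φ' (t, ξ)) f) t := by
  obtain rfl : Φ' = fun p => fderiv ℝ Φ p (1, 0) := by
    ext ⟨t, ξ⟩
    have hline : HasDerivAt (fun t => (t, ξ)) (1, 0) t :=
      (hasDerivAt_id t).prodMk (hasDerivAt_const t ξ)
    exact (hderiv t ξ).unique
      ((hΦ.1.differentiable (by simp) (t, ξ)).hasFDerivAt.comp_hasDerivAt t hline)
  exact hasDerivAt_smulLeftCLM_of_taylor (hasTemperateGrowth_slice hΦ)
    (hasTemperateGrowth_slice (hasTemperateGrowth_fderiv_apply hΦ (1, 0)) t)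
    (norm_iteratedFDeriv_slice_taylor_le hΦ t) f

end ParameterMultiplier

/-! ### Translations, reflections and convolution -/

section Convolution

variable {n : ℕ}

theorem translate_apply (a : Space n) (χ : Test n) (z : Space n) :
    translate a χ z = χ (z + a) := by
  simp [translate, sub_neg_eq_add]

theorem reflect_apply (χ : Test n) (z : Space n) : reflect χ z = χ (-z) := rfl

theorem dirac_apply (y : Space n) (χ : Test n) : dirac y χ = χ y := rfl

theorem shift_apply (F : Dist n) (y : Space n) (χ : Test n) :
    shift F y χ = F (translate y χ) := rfl

theorem translate_laplacian (a : Space n) (χ : Test n) :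
    translate a (Δ χ) = Δ (translate a χ) := by
  ext z
  rw [translate_apply, SchwartzMap.laplacian_apply, SchwartzMap.laplacian_apply,
    funext (translate_apply a χ),
    InnerProductSpace.laplacian_eq_iteratedFDeriv_stdOrthonormalBasis,
    InnerProductSpace.laplacian_eq_iteratedFDeriv_stdOrthonormalBasis]
  simp only [iteratedFDeriv_comp_add_right]

theorem reflect_laplacian (χ : Test n) : reflect (Δ χ) = Δ (reflect χ) := by
  have hderiv (v : Space n) (ψ : Test n) : ∂_{v} (reflect ψ) = -reflect (∂_{v} ψ) := by
    rw [reflect, SchwartzMap.lineDerivOp_compCLMOfContinuousLinearEquiv,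
      ContinuousLinearEquiv.coe_neg, Pi.neg_apply, id, LineDeriv.lineDerivOp_left_neg, map_neg]
  simp only [SchwartzMap.laplacian_eq_sum (stdOrthonormalBasis ℝ (Space n)), map_sum, hderiv,
    LineDeriv.lineDerivOp_neg, neg_neg]

theorem conv_eq {F : Dist n} {T : Test n →L[ℝ] Test n} (h : IsConvTranspose F T) (B : Dist n) :
    conv F B = B.comp T := by
  have hconv : IsConvolutor F := ⟨T, h⟩
  have hchoose : hconv.choose = T := by
    ext χ x
    rw [hconv.choose_spec χ x, h χ x]
  rw [conv, dif_pos hconv, hchoose]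

theorem conv_zero (F : Dist n) : conv F 0 = 0 := by
  unfold conv
  split_ifs
  · exact ContinuousLinearMap.zero_comp _
  · rfl

theorem convParam_eq {F : Dist n} {B C : Space n → Dist n} (h : IsConvParam F B C) :
    convParam F B = C := by
  have hexists : ∃ C, IsConvParam F B C := ⟨C, h⟩
  rw [convParam, dif_pos hexists]
  ext y χ
  obtain ⟨ψ₁, hψ₁, hC₁⟩ := hexists.choose_spec y χ
  obtain ⟨ψ₂, hψ₂, hC₂⟩ := h y χ
  have hψ : ψ₁ = ψ₂ := by
    ext z
    rw [hψ₁, hψ₂]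
  rw [hC₁, hC₂, hψ]

variable {P : Test n →L[ℝ] Test n}

theorem isConvTranspose_dirac_comp (ht : ∀ a χ, translate a (P χ) = P (translate a χ)) :
    IsConvTranspose ((dirac 0).comp P) P := fun χ x => by
  rw [ContinuousLinearMap.comp_apply, ← ht, dirac_apply, translate_apply, zero_add]

theorem convFun_dirac_comp (ht : ∀ a χ, translate a (P χ) = P (translate a χ))
    (hr : ∀ χ, reflect (P χ) = P (reflect χ)) (φ : Test n) (x : Space n) :
    convFun ((dirac 0).comp P) φ x = P φ x := by
  rw [convFun, ContinuousLinearMap.comp_apply, ← hr, ← ht, dirac_apply, reflect_apply,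
    translate_apply, neg_zero, zero_add]

theorem convParam_dirac_comp (ht : ∀ a χ, translate a (P χ) = P (translate a χ))
    (hr : ∀ χ, reflect (P χ) = P (reflect χ)) (T : Test n →L[ℝ] Test n) :
    convParam ((dirac 0).comp P) (fun w => (dirac w).comp T) =
      fun y => (dirac y).comp (P.comp T) := by
  refine convParam_eq fun y χ => ⟨reflect (translate y (T χ)), fun z => ?_, ?_⟩
  · rw [reflect_apply, translate_apply, neg_add_eq_sub, ContinuousLinearMap.comp_apply, dirac_apply]
  · exact (convFun_dirac_comp ht hr (T χ) y).symm

end Convolution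

/-! ### The propagators of the Klein–Gordon equation -/

section Multipliers

open SchwartzMap

variable {V F : Type*} [NormedAddCommGroup V] [NormedSpace ℝ V] [NormedAddCommGroup F]
  [NormedSpace ℝ F] {r : V → ℝ}

/-- The function `sin (t √r) / √r`, by which the Fourier transform of the initial velocity is
multiplied. It is `t` where `r` vanishes. -/
def sinMultiplier (r : V → ℝ) (t : ℝ) (ξ : V) : ℝ := t * sincSqrt (t ^ 2 * r ξ)

/-- The function `cos (t √r)`, by which the Fourier transform of the initial value is
multiplied. -/
def cosMultiplier (r : V → ℝ) (t : ℝ) (ξ : V) : ℝ := cosSqrt (t ^ 2 * r ξ)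

theorem hasTemperateGrowth_sq_mul (hr : r.HasTemperateGrowth) :
    Function.HasTemperateGrowth fun p : ℝ × V => p.1 ^ 2 * r p.2 :=
  ((ContinuousLinearMap.fst ℝ ℝ V).hasTemperateGrowth.pow 2).mul
    (hr.comp (ContinuousLinearMap.snd ℝ ℝ V).hasTemperateGrowth)

theorem hasTemperateGrowth_uncurry_sinMultiplier (hr : r.HasTemperateGrowth) (hr0 : ∀ ξ, 0 ≤ r ξ) :
    Function.HasTemperateGrowth fun p : ℝ × V => sinMultiplier r p.1 p.2 :=
  (ContinuousLinearMap.fst ℝ ℝ V).hasTemperateGrowth.mul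
    (hasTemperateGrowth_sincSqrt_comp (hasTemperateGrowth_sq_mul hr)
      fun p => mul_nonneg (sq_nonneg p.1) (hr0 p.2))

theorem hasTemperateGrowth_uncurry_cosMultiplier (hr : r.HasTemperateGrowth) (hr0 : ∀ ξ, 0 ≤ r ξ) :
    Function.HasTemperateGrowth fun p : ℝ × V => cosMultiplier r p.1 p.2 :=
  hasTemperateGrowth_cosSqrt_comp (hasTemperateGrowth_sq_mul hr)
    fun p => mul_nonneg (sq_nonneg p.1) (hr0 p.2)

theorem hasTemperateGrowth_sinMultiplier (hr : r.HasTemperateGrowth) (hr0 : ∀ ξ, 0 ≤ r ξ) (t : ℝ) :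
    (sinMultiplier r t).HasTemperateGrowth :=
  hasTemperateGrowth_slice (hasTemperateGrowth_uncurry_sinMultiplier hr hr0) t

theorem hasDerivAt_sinMultiplier {X : Type*} (r : X → ℝ) (t : ℝ) (ξ : X) :
    HasDerivAt (fun t => sinMultiplier r t ξ) (cosMultiplier r t ξ) t :=
  hasDerivAt_mul_sincSqrt_sq_mul (r ξ) t

theorem hasDerivAt_cosMultiplier {X : Type*} (r : X → ℝ) (t : ℝ) (ξ : X) :
    HasDerivAt (fun t => cosMultiplier r t ξ) (-(r * sinMultiplier r t) ξ) t := by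
  have hinner : HasDerivAt (fun t => t ^ 2 * r ξ) (2 * t * r ξ) t := by
    simpa using (hasDerivAt_pow 2 t).mul_const (r ξ)
  refine ((hasDerivAt_cosSqrt _).comp t hinner).congr_deriv ?_
  simp only [Pi.mul_apply, sinMultiplier]
  ring

theorem hasDerivAt_smulLeftCLM_sinMultiplier (hr : r.HasTemperateGrowth) (hr0 : ∀ ξ, 0 ≤ r ξ)
    (f : 𝓢(V, F)) (t : ℝ) :
    HasDerivAt (fun t => smulLeftCLM F (sinMultiplier r t) f)
      (smulLeftCLM F (cosMultiplier r t) f) t :=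
  hasDerivAt_smulLeftCLM_slice (Φ' := fun p => cosMultiplier r p.1 p.2)
    (hasTemperateGrowth_uncurry_sinMultiplier hr hr0) (hasDerivAt_sinMultiplier r) f t

theorem hasDerivAt_smulLeftCLM_cosMultiplier (hr : r.HasTemperateGrowth) (hr0 : ∀ ξ, 0 ≤ r ξ)
    (f : 𝓢(V, F)) (t : ℝ) :
    HasDerivAt (fun t => smulLeftCLM F (cosMultiplier r t) f)
      (-smulLeftCLM F (r * sinMultiplier r t) f) t := by
  rw [← neg_apply, ← smulLeftCLM_neg (hr.mul (hasTemperateGrowth_sinMultiplier hr hr0 t))]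
  exact hasDerivAt_smulLeftCLM_slice (Φ' := fun p => -(r * sinMultiplier r p.1) p.2)
    (hasTemperateGrowth_uncurry_cosMultiplier hr hr0) (hasDerivAt_cosMultiplier r) f t

end Multipliers

section Propagator

open SchwartzMap FourierTransform

variable {n : ℕ} {m : ℝ}

/-- The symbol `(2π)²‖ξ‖² + m²` of the operator `-Δ + m²`; the factor comes from the normalization
`exp (-2πi⟪x, ξ⟫)` of the Fourier transform. -/
def kgSymbol (m : ℝ) (ξ : Space n) : ℝ := (2 * Real.pi) ^ 2 * ‖ξ‖ ^ 2 + m ^ 2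

/-- The operator `Δ - m²`. -/
def kgOp (m : ℝ) : Test n →L[ℝ] Test n :=
  LineDeriv.laplacianCLM ℝ (Space n) (Test n) - m ^ 2 • ContinuousLinearMap.id ℝ (Test n)

theorem kgOp_apply (χ : Test n) : kgOp m χ = Δ χ - m ^ 2 • χ := rfl

theorem map_kgOp {L : Test n →L[ℝ] Test n} (hL : ∀ χ, L (Δ χ) = Δ (L χ)) (χ : Test n) :
    L (kgOp m χ) = kgOp m (L χ) := by
  rw [kgOp_apply, map_sub, map_smul, hL, kgOp_apply]

theorem hasTemperateGrowth_kgSymbol (m : ℝ) : (kgSymbol (n := n) m).HasTemperateGrowth := by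
  unfold kgSymbol
  fun_prop

theorem kgSymbol_nonneg (m : ℝ) (ξ : Space n) : 0 ≤ kgSymbol m ξ := by
  unfold kgSymbol
  positivity

theorem postcompCLM_laplacian {E F G : Type*} [NormedAddCommGroup E] [InnerProductSpace ℝ E]
    [FiniteDimensional ℝ E] [NormedAddCommGroup F] [NormedSpace ℝ F] [NormedAddCommGroup G]
    [NormedSpace ℝ G] (L : F →L[ℝ] G) (f : 𝓢(E, F)) :
    (postcompCLM L (Δ f) : 𝓢(E, G)) = Δ (postcompCLM L f : 𝓢(E, G)) := by
  ext x
  rw [laplacian_apply, postcompCLM_apply, laplacian_apply]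
  exact ((f.smooth 2).contDiffAt.laplacian_CLM_comp_left (l := L)).symm

/-- The inclusion of real into complex Schwartz functions; the Fourier transform is only available
on the latter. -/
def ofRealS : Test n →L[ℝ] 𝓢(Space n, ℂ) := postcompCLM Complex.ofRealCLM

/-- The real part of a complex Schwartz function. -/
def reS : 𝓢(Space n, ℂ) →L[ℝ] Test n := postcompCLM Complex.reCLM

theorem reS_ofRealS (χ : Test n) : reS (ofRealS χ) = χ := by
  ext x
  simp [reS, ofRealS]

/-- The operator `sin (t √(-Δ + m²)) / √(-Δ + m²)`, mapping the initial velocity to the solution. -/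
def sinProp (m t : ℝ) : Test n →L[ℝ] Test n :=
  reS ∘L fourierMultiplierCLM ℂ (sinMultiplier (kgSymbol m) t) ∘L ofRealS

/-- The operator `cos (t √(-Δ + m²))`, mapping the initial value to the solution. -/
def cosProp (m t : ℝ) : Test n →L[ℝ] Test n :=
  reS ∘L fourierMultiplierCLM ℂ (cosMultiplier (kgSymbol m) t) ∘L ofRealS

theorem sinProp_zero (χ : Test n) : sinProp m 0 χ = 0 := by
  have hmult : sinMultiplier (kgSymbol (n := n) m) 0 = fun _ => 0 := by
    ext ξ
    simp [sinMultiplier]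
  simp [sinProp, hmult, fourierMultiplierCLM_const]

theorem cosProp_zero (χ : Test n) : cosProp m 0 χ = χ := by
  have hmult : cosMultiplier (kgSymbol (n := n) m) 0 = fun _ => 1 := by
    ext ξ
    simp [cosMultiplier, cosSqrt_zero]
  simp [cosProp, hmult, fourierMultiplierCLM_const, reS_ofRealS]

theorem sinProp_neg (t : ℝ) (χ : Test n) : sinProp m (-t) χ = -sinProp m t χ := by
  have hmult : sinMultiplier (kgSymbol (n := n) m) (-t) =
      (-1 : ℝ) • sinMultiplier (kgSymbol m) t := by
    ext ξ
    simp [sinMultiplier]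
  have hgrowth := hasTemperateGrowth_sinMultiplier (hasTemperateGrowth_kgSymbol (n := n) m)
    (kgSymbol_nonneg m) t
  simp only [sinProp, ContinuousLinearMap.comp_apply, hmult]
  rw [fourierMultiplierCLM_smul hgrowth, smul_apply, map_smul, neg_one_smul]

theorem cosProp_neg (t : ℝ) (χ : Test n) : cosProp m (-t) χ = cosProp m t χ := by
  simp only [cosProp, funext fun ξ => show cosMultiplier (kgSymbol (n := n) m) (-t) ξ =
    cosMultiplier (kgSymbol m) t ξ by simp [cosMultiplier]]

theorem fourierMultiplierCLM_kgSymbol (m : ℝ) (f : 𝓢(Space n, ℂ)) :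
    fourierMultiplierCLM ℂ (kgSymbol m) f = -(Δ f - m ^ 2 • f) := by
  have hsq : Function.HasTemperateGrowth fun ξ : Space n => ‖ξ‖ ^ 2 := by fun_prop
  have hsymbol : smulLeftCLM ℂ (kgSymbol m) (𝓕 f) =
      (2 * Real.pi) ^ 2 • smulLeftCLM ℂ (fun ξ : Space n => ‖ξ‖ ^ 2) (𝓕 f) + m ^ 2 • 𝓕 f := by
    ext ξ
    simp only [add_apply, smul_apply, smulLeftCLM_apply_apply hsq,
      smulLeftCLM_apply_apply (hasTemperateGrowth_kgSymbol m), kgSymbol]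
    module
  rw [fourierMultiplierCLM_apply, hsymbol, fourierInv_add, fourierInv_smul, fourierInv_smul,
    fourierInv_fourier_eq, ← fourierMultiplierCLM_apply, laplacian_eq_fourierMultiplierCLM]
  module

theorem reS_fourierMultiplierCLM_kgSymbol (m : ℝ) (f : 𝓢(Space n, ℂ)) :
    reS (fourierMultiplierCLM ℂ (kgSymbol m) f) = -kgOp m (reS f) := by
  rw [fourierMultiplierCLM_kgSymbol, map_neg, map_sub, map_smul, reS, postcompCLM_laplacian,
    kgOp_apply]

theorem fourierMultiplierCLM_kgSymbol_ofRealS (m : ℝ) (χ : Test n) :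
    fourierMultiplierCLM ℂ (kgSymbol m) (ofRealS χ) = -ofRealS (kgOp m χ) := by
  rw [fourierMultiplierCLM_kgSymbol, kgOp_apply, map_sub, map_smul, ofRealS, postcompCLM_laplacian]

theorem kgOp_sinProp (t : ℝ) (χ : Test n) : kgOp m (sinProp m t χ) = sinProp m t (kgOp m χ) := by
  have hr := hasTemperateGrowth_kgSymbol (n := n) m
  have hs := hasTemperateGrowth_sinMultiplier hr (kgSymbol_nonneg m) t
  refine neg_injective ?_
  calc -kgOp m (sinProp m t χ) = reS (fourierMultiplierCLM ℂ (kgSymbol m)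
        (fourierMultiplierCLM ℂ (sinMultiplier (kgSymbol m) t) (ofRealS χ))) :=
      (reS_fourierMultiplierCLM_kgSymbol m _).symm
    _ = reS (fourierMultiplierCLM ℂ (sinMultiplier (kgSymbol m) t)
        (fourierMultiplierCLM ℂ (kgSymbol m) (ofRealS χ))) := by
      rw [fourierMultiplierCLM_fourierMultiplierCLM_apply hr hs,
        fourierMultiplierCLM_fourierMultiplierCLM_apply hs hr, mul_comm]
    _ = -sinProp m t (kgOp m χ) := by
      rw [fourierMultiplierCLM_kgSymbol_ofRealS, map_neg, map_neg]
      rfl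

theorem hasDerivAt_sinProp (m : ℝ) (χ : Test n) (t : ℝ) :
    HasDerivAt (fun t => sinProp m t χ) (cosProp m t χ) t :=
  hasDerivAt_clm_comp (reS ∘L fourierInvCLM ℝ 𝓢(Space n, ℂ))
    (hasDerivAt_smulLeftCLM_sinMultiplier (hasTemperateGrowth_kgSymbol m) (kgSymbol_nonneg m)
      (𝓕 (ofRealS χ)) t)

theorem hasDerivAt_cosProp (m : ℝ) (χ : Test n) (t : ℝ) :
    HasDerivAt (fun t => cosProp m t χ) (kgOp m (sinProp m t χ)) t := by
  have hr := hasTemperateGrowth_kgSymbol (n := n) m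
  have hs := hasTemperateGrowth_sinMultiplier hr (kgSymbol_nonneg m) t
  have hvelocity : (reS ∘L fourierInvCLM ℝ 𝓢(Space n, ℂ))
      (-smulLeftCLM ℂ (kgSymbol m * sinMultiplier (kgSymbol m) t) (𝓕 (ofRealS χ))) =
      kgOp m (sinProp m t χ) := by
    rw [map_neg, ContinuousLinearMap.comp_apply, fourierInvCLM_apply, ← fourierMultiplierCLM_apply,
      ← fourierMultiplierCLM_fourierMultiplierCLM_apply hr hs, reS_fourierMultiplierCLM_kgSymbol,
      neg_neg]
    rfl
  exact hvelocity ▸ hasDerivAt_clm_comp (reS ∘L fourierInvCLM ℝ 𝓢(Space n, ℂ))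
    (hasDerivAt_smulLeftCLM_cosMultiplier hr (kgSymbol_nonneg m) (𝓕 (ofRealS χ)) t)

end Propagator

/-! ### The Cauchy problem -/

section Cauchy

variable {n : ℕ} {m : ℝ} {u v : ℝ → Test n} {D D' : ℝ → Dist n}

theorem isKleinGordon_sinProp (χ : Test n) :
    IsKleinGordon m (fun t => sinProp m t χ) fun t => cosProp m t χ :=
  ⟨hasDerivAt_sinProp m χ, hasDerivAt_cosProp m χ⟩

theorem isKleinGordon_cosProp (χ : Test n) :
    IsKleinGordon m (fun t => cosProp m t χ) fun t => kgOp m (sinProp m t χ) where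
  velocity := hasDerivAt_cosProp m χ
  equation t := hasDerivAt_clm_comp (kgOp m) (hasDerivAt_sinProp m χ t)

theorem IsKleinGordon.add {u₁ v₁ u₂ v₂ : ℝ → Test n} (h₁ : IsKleinGordon m u₁ v₁)
    (h₂ : IsKleinGordon m u₂ v₂) :
    IsKleinGordon m (fun t => u₁ t + u₂ t) fun t => v₁ t + v₂ t where
  velocity t := hasDerivAt_curve_add (h₁.velocity t) (h₂.velocity t)
  equation t := by
    rw [← kgOp_apply, map_add]
    exact hasDerivAt_curve_add (h₁.equation t) (h₂.equation t)

theorem IsKleinGordon.map (h : IsKleinGordon m u v) {L : Test n →L[ℝ] Test n}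
    (hL : ∀ χ, L (Δ χ) = Δ (L χ)) : IsKleinGordon m (fun t => L (u t)) fun t => L (v t) where
  velocity t := hasDerivAt_clm_comp L (h.velocity t)
  equation t := by
    rw [← kgOp_apply, ← map_kgOp hL]
    exact hasDerivAt_clm_comp L (h.equation t)

theorem exists_isCauchySolution (φ π : Test n) : ∃ u v, IsCauchySolution m φ π u v :=
  ⟨_, _, (isKleinGordon_sinProp π).add (isKleinGordon_cosProp φ),
    by simp [sinProp_zero, cosProp_zero], by simp [sinProp_zero, cosProp_zero]⟩

/-- The Klein–Gordon equation for a curve `D` of tempered distributions that is weakly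
differentiable, with weak time derivative `D'`: an `IsGreenFunction` without its initial
conditions. -/
structure IsWeakKleinGordon (m : ℝ) (D D' : ℝ → Dist n) : Prop where
  velocity : ∀ t χ, HasDerivAt (fun τ => D τ χ) (D' t χ) t
  equation : ∀ t χ, HasDerivAt (fun τ => D' τ χ) (D t (kgOp m χ)) t

theorem IsGreenFunction.isWeakKleinGordon (h : IsGreenFunction m D D') :
    IsWeakKleinGordon m D D' :=
  ⟨h.velocity, h.equation⟩

theorem isWeakKleinGordon_comp_sinProp (F : Dist n) :
    IsWeakKleinGordon m (fun t => F.comp (sinProp m t)) fun t => F.comp (cosProp m t) where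
  velocity t χ := hasDerivAt_clm_comp F (hasDerivAt_sinProp m χ t)
  equation t χ := by
    rw [ContinuousLinearMap.comp_apply, ← kgOp_sinProp]
    exact hasDerivAt_clm_comp F (hasDerivAt_cosProp m χ t)

theorem IsWeakKleinGordon.hasDerivAt_pairing (hD : IsWeakKleinGordon m D D')
    (h : IsKleinGordon m u v) (c t : ℝ) :
    HasDerivAt (fun τ => D (c - τ) (v τ) + D' (c - τ) (u τ)) 0 t := by
  have hvelocity (τ : ℝ) (χ : Test n) :
      HasDerivAt (fun τ => D (c - τ) χ) (-D' (c - τ) χ) τ := by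
    simpa using (hD.velocity (c - τ) χ).comp_const_sub c τ
  have hequation (τ : ℝ) (χ : Test n) :
      HasDerivAt (fun τ => D' (c - τ) χ) (-D (c - τ) (kgOp m χ)) τ := by
    simpa using (hD.equation (c - τ) χ).comp_const_sub c τ
  refine ((hasDerivAt_apply_of_barrelled hvelocity (h.equation t)).add
    (hasDerivAt_apply_of_barrelled hequation (h.velocity t))).congr_deriv ?_
  rw [kgOp_apply]
  ring

theorem IsWeakKleinGordon.pairing_eq (hD : IsWeakKleinGordon m D D') (h : IsKleinGordon m u v)
    (c t s : ℝ) : D (c - t) (v t) + D' (c - t) (u t) = D (c - s) (v s) + D' (c - s) (u s) :=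
  is_const_of_deriv_eq_zero (fun τ => (hD.hasDerivAt_pairing h c τ).differentiableAt)
    (fun τ => (hD.hasDerivAt_pairing h c τ).deriv) t s

theorem IsWeakKleinGordon.eq_prop (hD : IsWeakKleinGordon m D D') (t s : ℝ) (χ : Test n) :
    D t χ = D s (cosProp m (t - s) χ) + D' s (sinProp m (t - s) χ) := by
  simpa [sinProp_zero, cosProp_zero] using hD.pairing_eq (isKleinGordon_sinProp χ) t 0 (t - s)

theorem IsKleinGordon.eq_prop (h : IsKleinGordon m u v) (t s : ℝ) :
    u t = sinProp m (t - s) (v s) + cosProp m (t - s) (u s) := by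
  ext x
  simpa [sinProp_zero, cosProp_zero, dirac_apply] using
    (isWeakKleinGordon_comp_sinProp (dirac x)).pairing_eq h t t s

theorem sinProp_sub (t s : ℝ) (χ : Test n) :
    sinProp m (t - s) χ = cosProp m s (sinProp m t χ) - sinProp m s (cosProp m t χ) := by
  rw [(isKleinGordon_sinProp χ).eq_prop (t - s) t, sub_sub_cancel_left, sinProp_neg, cosProp_neg,
    neg_add_eq_sub]

theorem map_sinProp {L : Test n →L[ℝ] Test n} (hL : ∀ χ, L (Δ χ) = Δ (L χ)) (t : ℝ) (χ : Test n) :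
    L (sinProp m t χ) = sinProp m t (L χ) := by
  simpa [sinProp_zero, cosProp_zero] using ((isKleinGordon_sinProp (m := m) χ).map hL).eq_prop t 0

theorem map_cosProp {L : Test n →L[ℝ] Test n} (hL : ∀ χ, L (Δ χ) = Δ (L χ)) (t : ℝ) (χ : Test n) :
    L (cosProp m t χ) = cosProp m t (L χ) := by
  simpa [sinProp_zero, cosProp_zero] using ((isKleinGordon_cosProp (m := m) χ).map hL).eq_prop t 0

theorem ofFunction_apply (f χ : Test n) : ofFunction f χ = ∫ x, f x * χ x := by
  simp [ofFunction, SchwartzMap.integralCLM_apply,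
    SchwartzMap.smulLeftCLM_apply_apply f.hasTemperateGrowth]

theorem ofFunction_comm (f g : Test n) : ofFunction f g = ofFunction g f := by
  simp only [ofFunction_apply, mul_comm]

theorem ofFunction_kgOp (f g : Test n) : ofFunction f (kgOp m g) = ofFunction g (kgOp m f) := by
  have hlaplacian : ofFunction f (Δ g) = ofFunction g (Δ f) := by
    rw [ofFunction_apply, ofFunction_comm, ofFunction_apply]
    exact SchwartzMap.integral_mul_laplacian_right_eq_left f g
  rw [kgOp_apply, kgOp_apply, map_sub, map_sub, map_smul, map_smul, hlaplacian,
    ofFunction_comm f g]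

theorem IsKleinGordon.isWeakKleinGordon (h : IsKleinGordon m u v) :
    IsWeakKleinGordon m (fun t => ofFunction (u t)) fun t => ofFunction (v t) where
  velocity t χ := by
    simp only [ofFunction_comm _ χ]
    exact hasDerivAt_clm_comp (ofFunction χ) (h.velocity t)
  equation t χ := by
    rw [ofFunction_kgOp]
    simp only [ofFunction_comm _ χ]
    exact hasDerivAt_clm_comp (ofFunction χ) (h.equation t)

end Cauchy

/-! ### Brackets and star products of the canonical coordinates -/

section Brackets

variable {n : ℕ}

theorem mderiv_zero : mderiv (0 : MultiIndex n) = ContinuousLinearMap.id ℝ (Test n) := by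
  simp only [mderiv, Finsupp.coe_zero, Pi.zero_apply, pow_zero, List.map_const',
    List.prod_replicate, one_pow]
  rfl

theorem deltaDeriv_zero (y : Space n) : deltaDeriv 0 y = dirac y := by
  simp [deltaDeriv, mderiv_zero]

theorem deriv_update_apply {ι : Type*} [DecidableEq ι] (j : ι → ℝ) (a b : ι) (x : ℝ) :
    deriv (fun s => Function.update j a s b) x = if a = b then 1 else 0 := by
  rcases eq_or_ne a b with rfl | h
  · simp
  · simp [Function.update_of_ne h.symm, h]

theorem Coeff.d₁_d₂_mulDelta_coord (a b e f : MultiIndex n ⊕ MultiIndex n)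
    (q : MultiIndex n × MultiIndex n) (j k : Jet n) :
    Coeff.d₁ e (Coeff.d₂ f (FormalKernel.mulDelta (HamFun.coord a) (HamFun.coord b) q)) j k =
      if q = 0 ∧ e = a ∧ f = b then 1 else 0 := by
  by_cases hq : q = 0
  · simp only [Coeff.d₁, Coeff.d₂, FormalKernel.mulDelta, HamFun.coord, hq, if_true,
      deriv_const_mul_field, deriv_mul_const_field, deriv_update_apply]
    by_cases h1 : e = a <;> by_cases h2 : f = b <;> simp [h1, h2]
  · simp [Coeff.d₁, Coeff.d₂, FormalKernel.mulDelta, hq]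

theorem sum_antidiagonal_eq_of_snd_eq_zero {A M : Type*} [AddCommMonoid A]
    [Finset.HasAntidiagonal A] [AddCommMonoid M] (a : A) {F : A × A → M}
    (hF : ∀ c, c.2 ≠ 0 → F c = 0) :
    ∑ c ∈ Finset.HasAntidiagonal.antidiagonal a, F c = F (a, 0) := by
  refine Finset.sum_eq_single (a, 0) (fun c hc hne => hF c fun hzero => hne ?_) fun h => ?_
  · rw [Finset.HasAntidiagonal.mem_antidiagonal, hzero, add_zero] at hc
    exact Prod.ext hc hzero
  · exact absurd (Finset.HasAntidiagonal.mem_antidiagonal.2 (add_zero a)) h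

theorem FormalKernel.poissonOp_mulDelta_coord (a b : MultiIndex n ⊕ MultiIndex n) :
    (FormalKernel.mulDelta (HamFun.coord a) (HamFun.coord b)).poissonOp = fun p _ _ =>
      (if Sum.inl p.1 = a ∧ Sum.inr p.2 = b then 1 else 0) -
        if Sum.inr p.1 = a ∧ Sum.inl p.2 = b then 1 else 0 := by
  funext p j k
  simp only [FormalKernel.poissonOp, Coeff.d₁_d₂_mulDelta_coord]
  rw [sum_antidiagonal_eq_of_snd_eq_zero, sum_antidiagonal_eq_of_snd_eq_zero]
  · simp
  · intro d hd
    simp [hd]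
  · intro c hc
    simp [hc]

theorem FormalKernel.poissonOp_const (c : MultiIndex n × MultiIndex n → ℝ) :
    FormalKernel.poissonOp (fun p _ _ => c p) = 0 := by
  funext p j k
  simp [FormalKernel.poissonOp, Coeff.d₁, Coeff.d₂]

theorem FormalKernel.poissonOp_iterate_zero (k : ℕ) :
    FormalKernel.poissonOp^[k] (0 : FormalKernel n) = 0 :=
  Function.iterate_fixed (FormalKernel.poissonOp_const 0) k

theorem FormalKernel.eval_const (c : MultiIndex n × MultiIndex n → ℝ) (φ π : Test n)
    (y : Space n) :
    FormalKernel.eval (fun p _ _ => c p) φ π y = ∑ᶠ p, c p • deltaDeriv p y := by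
  simp [FormalKernel.eval, SchwartzMap.smulLeftCLM_const]

theorem FormalKernel.eval_zero (φ π : Test n) (y : Space n) :
    (0 : FormalKernel n).eval φ π y = 0 :=
  (FormalKernel.eval_const 0 φ π y).trans (by simp)

variable (φ π : Test n) (y : Space n)

theorem bracketDelta_inl_inr (α β : MultiIndex n) :
    bracketDelta (HamFun.coord (Sum.inl α)) (HamFun.coord (Sum.inr β)) φ π y =
      deltaDeriv (α, β) y := by
  rw [bracketDelta, FormalKernel.poissonOp_mulDelta_coord, FormalKernel.eval_const,
    finsum_eq_single _ (α, β) fun p hp => by simp [mt Prod.ext_iff.2 hp]]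
  simp

theorem bracketDelta_inr_inl (α β : MultiIndex n) :
    bracketDelta (HamFun.coord (Sum.inr α)) (HamFun.coord (Sum.inl β)) φ π y =
      -deltaDeriv (α, β) y := by
  rw [bracketDelta, FormalKernel.poissonOp_mulDelta_coord, FormalKernel.eval_const,
    finsum_eq_single _ (α, β) fun p hp => by simp [mt Prod.ext_iff.2 hp]]
  simp [neg_one_smul ℝ (deltaDeriv (α, β) y)]

theorem bracketDelta_inl_inl (α β : MultiIndex n) :
    bracketDelta (HamFun.coord (Sum.inl α)) (HamFun.coord (Sum.inl β)) φ π y = 0 := by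
  rw [bracketDelta, FormalKernel.poissonOp_mulDelta_coord, FormalKernel.eval_const]
  simp

theorem bracketDelta_inr_inr (α β : MultiIndex n) :
    bracketDelta (HamFun.coord (Sum.inr α)) (HamFun.coord (Sum.inr β)) φ π y = 0 := by
  rw [bracketDelta, FormalKernel.poissonOp_mulDelta_coord, FormalKernel.eval_const]
  simp

theorem bracketDelta_phi_pi : bracketDelta HamFun.phi HamFun.pi φ π y = dirac y :=
  (bracketDelta_inl_inr φ π y 0 0).trans (deltaDeriv_zero y)

theorem bracketDelta_pi_phi : bracketDelta HamFun.pi HamFun.phi φ π y = -dirac y :=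
  (bracketDelta_inr_inl φ π y 0 0).trans (congrArg Neg.neg (deltaDeriv_zero y))

theorem bracketDelta_phi_phi : bracketDelta HamFun.phi HamFun.phi φ π y = 0 :=
  bracketDelta_inl_inl φ π y 0 0

theorem bracketDelta_pi_pi : bracketDelta HamFun.pi HamFun.pi φ π y = 0 :=
  bracketDelta_inr_inr φ π y 0 0

theorem HamFun.phi_jet (x : Space n) : HamFun.phi.toFun (jet φ π x) = φ x := by
  simp [HamFun.phi, HamFun.coord, jet, mderiv_zero]

theorem HamFun.pi_jet (x : Space n) : HamFun.pi.toFun (jet φ π x) = π x := by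
  simp [HamFun.pi, HamFun.coord, jet, mderiv_zero]

theorem ofFunction_mul_const (f : Test n) (c : ℝ) :
    ofFunction (fun x => f x * c) = c • ofFunction f := by
  have hsmul : (fun x => f x * c) = c • (f : Space n → ℝ) := funext fun x => mul_comm _ _
  rw [hsmul, ofFunction, SchwartzMap.smulLeftCLM_smul f.hasTemperateGrowth,
    ContinuousLinearMap.comp_smul, ofFunction]

theorem starDelta_phi_phi_zero :
    starDelta HamFun.phi HamFun.phi φ π y 0 = φ y • ofFunction φ := by
  simp only [starDelta, HamFun.phi_jet, ofFunction_mul_const]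

theorem starDelta_pi_phi_zero :
    starDelta HamFun.pi HamFun.phi φ π y 0 = φ y • ofFunction π := by
  simp only [starDelta, HamFun.phi_jet, HamFun.pi_jet, ofFunction_mul_const]

theorem starDelta_one (f g : HamFun n) :
    starDelta f g φ π y 1 = bracketDelta f g φ π y := by
  simp [starDelta, bracketDelta]

theorem starDelta_coord_add_two (a b : MultiIndex n ⊕ MultiIndex n) (k : ℕ) :
    starDelta (HamFun.coord a) (HamFun.coord b) φ π y (k + 2) = 0 := by
  rw [starDelta, Function.iterate_succ_apply, Function.iterate_succ_apply,
    FormalKernel.poissonOp_mulDelta_coord, FormalKernel.poissonOp_const,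
    FormalKernel.poissonOp_iterate_zero, FormalKernel.eval_zero, smul_zero]

end Brackets

/-! ### The Green function -/

section Green

variable {n : ℕ} {m : ℝ}

/-- The Green function `Δ(t, ·)` of the Klein–Gordon equation, the kernel of the propagator
`sinProp` at the origin. -/
def green (m t : ℝ) : Dist n := (dirac 0).comp (sinProp m t)

/-- The time derivative `∂_t Δ(t, ·)` of the Green function. -/
def green' (m t : ℝ) : Dist n := (dirac 0).comp (cosProp m t)

theorem isGreenFunction_green : IsGreenFunction (n := n) m (green m) (green' m) where
  velocity := (isWeakKleinGordon_comp_sinProp (dirac 0)).velocity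
  equation := (isWeakKleinGordon_comp_sinProp (dirac 0)).equation
  init := by
    ext χ
    simp [green, sinProp_zero]
  init_velocity := by
    ext χ
    simp [green', cosProp_zero]

theorem IsGreenFunction.eq_green {D D' : ℝ → Dist n} (h : IsGreenFunction m D D') :
    D = green m ∧ D' = green' m := by
  have hD : D = green m := by
    ext t χ
    simpa [green, h.init, h.init_velocity] using h.isWeakKleinGordon.eq_prop t 0 χ
  refine ⟨hD, ?_⟩
  ext t χ
  exact (h.velocity t χ).unique (hD ▸ isGreenFunction_green.velocity t χ)

theorem isConvTranspose_green (t : ℝ) : IsConvTranspose (green (n := n) m t) (sinProp m t) :=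
  isConvTranspose_dirac_comp fun a => map_sinProp (translate_laplacian a) t

theorem isConvTranspose_green' (t : ℝ) : IsConvTranspose (green' (n := n) m t) (cosProp m t) :=
  isConvTranspose_dirac_comp fun a => map_cosProp (translate_laplacian a) t

theorem conv_green (t : ℝ) (B : Dist n) : conv (green m t) B = B.comp (sinProp m t) :=
  conv_eq (isConvTranspose_green t) B

theorem conv_green' (t : ℝ) (B : Dist n) : conv (green' m t) B = B.comp (cosProp m t) :=
  conv_eq (isConvTranspose_green' t) B

theorem shift_green (t : ℝ) (y : Space n) :
    shift (green m t) y = (dirac y).comp (sinProp m t) := by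
  ext χ
  rw [shift_apply, ← isConvTranspose_green, ContinuousLinearMap.comp_apply, dirac_apply]

theorem convFun_green (t : ℝ) (φ : Test n) (x : Space n) :
    convFun (green m t) φ x = sinProp m t φ x :=
  convFun_dirac_comp (fun a => map_sinProp (translate_laplacian a) t)
    (map_sinProp reflect_laplacian t) φ x

theorem convFun_green' (t : ℝ) (φ : Test n) (x : Space n) :
    convFun (green' m t) φ x = cosProp m t φ x :=
  convFun_dirac_comp (fun a => map_cosProp (translate_laplacian a) t)
    (map_cosProp reflect_laplacian t) φ x

theorem convParam_green (t : ℝ) (T : Test n →L[ℝ] Test n) :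
    convParam (green m t) (fun w => (dirac w).comp T) =
      fun y => (dirac y).comp ((sinProp m t).comp T) :=
  convParam_dirac_comp (fun a => map_sinProp (translate_laplacian a) t)
    (map_sinProp reflect_laplacian t) T

theorem convParam_green' (t : ℝ) (T : Test n →L[ℝ] Test n) :
    convParam (green' m t) (fun w => (dirac w).comp T) =
      fun y => (dirac y).comp ((cosProp m t).comp T) :=
  convParam_dirac_comp (fun a => map_cosProp (translate_laplacian a) t)
    (map_cosProp reflect_laplacian t) T

end Green

/-! ### Brackets and star products at different times -/

section SpaceTime

variable {n : ℕ} {m : ℝ}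

theorem IsCauchySolution.apply_eq_convFun {φ π : Test n} {u v : ℝ → Test n}
    (h : IsCauchySolution m φ π u v) (t : ℝ) (x : Space n) :
    u t x = convFun (green m t) π x + convFun (green' m t) φ x := by
  rw [convFun_green, convFun_green', h.eq_prop t 0, sub_zero, h.init, h.init_velocity]
  rfl

theorem bracket_green (u v : ℝ → Test n) (t s : ℝ) (y : Space n) :
    bracket (green m) (green' m) u v t s y = -shift (green m (t - s)) y := by
  rw [bracket, bracketDelta_pi_phi, bracketDelta_phi_phi, conv_green, conv_green', shift_green,
    ContinuousLinearMap.zero_comp, add_zero, ContinuousLinearMap.neg_comp]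

theorem bracketInitial_green (φ π : Test n) (t s : ℝ) (y : Space n) :
    bracketInitial (green m) (green' m) φ π t s y = -shift (green m (t - s)) y := by
  have hpi_pi : (fun w => conv (green m t) (bracketDelta HamFun.pi HamFun.pi φ π w)) =
      fun w => (dirac w).comp (0 : Test n →L[ℝ] Test n) := by
    simp [bracketDelta_pi_pi, conv_zero]
  have hpi_phi : (fun w => conv (green m t) (bracketDelta HamFun.pi HamFun.phi φ π w)) =
      fun w => (dirac w).comp (-sinProp m t) := by
    simp [bracketDelta_pi_phi, conv_green]
  have hphi_pi : (fun w => conv (green' m t) (bracketDelta HamFun.phi HamFun.pi φ π w)) =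
      fun w => (dirac w).comp (cosProp m t) := by
    simp [bracketDelta_phi_pi, conv_green']
  have hphi_phi : (fun w => conv (green' m t) (bracketDelta HamFun.phi HamFun.phi φ π w)) =
      fun w => (dirac w).comp (0 : Test n →L[ℝ] Test n) := by
    simp [bracketDelta_phi_phi, conv_zero]
  rw [bracketInitial, hpi_pi, hpi_phi, hphi_pi, hphi_phi, shift_green]
  simp only [convParam_green, convParam_green']
  ext χ
  simp [sinProp_sub, neg_add_eq_sub]

theorem star_green_zero {u v : ℝ → Test n} (h : IsKleinGordon m u v) (t s : ℝ) (y : Space n) :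
    star (green m) (green' m) u v t s y 0 = ofFunction fun x => u t x * u s y := by
  rw [star, starDelta_pi_phi_zero, starDelta_phi_phi_zero, conv_green, conv_green',
    ofFunction_mul_const]
  ext χ
  simp [h.isWeakKleinGordon.eq_prop t s χ, mul_add, add_comm]

theorem star_one (G G' : ℝ → Dist n) (u v : ℝ → Test n) (t s : ℝ) (y : Space n) :
    star G G' u v t s y 1 = bracket G G' u v t s y := by
  simp only [star, bracket, starDelta_one]

theorem star_add_two (G G' : ℝ → Dist n) (u v : ℝ → Test n) (t s : ℝ) (y : Space n) (k : ℕ) :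
    star G G' u v t s y (k + 2) = 0 := by
  rw [star, HamFun.pi, HamFun.phi, starDelta_coord_add_two, starDelta_coord_add_two, conv_zero,
    conv_zero, add_zero]

theorem star_green {u v : ℝ → Test n} (h : IsKleinGordon m u v) (t s : ℝ) (y : Space n) :
    star (green m) (green' m) u v t s y =
      Pi.single (M := fun _ => Dist n) 0 (ofFunction fun x => u t x * u s y) +
        Pi.single (M := fun _ => Dist n) 1 (bracket (green m) (green' m) u v t s y) := by
  funext k
  rcases k with - | - | k
  · simp [star_green_zero h]
  · simp [star_one]
  · simp [star_add_two]

end SpaceTime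

end Peierls

end

theorem mainTheorem9 (n : ℕ) (m : ℝ) :
    ∃ G G' : ℝ → Peierls.Dist n,
      Peierls.IsGreenFunction m G G' ∧
      (∀ D D' : ℝ → Peierls.Dist n, Peierls.IsGreenFunction m D D' → D = G ∧ D' = G') ∧
      (∀ t, Peierls.IsConvolutor (G t) ∧ Peierls.IsConvolutor (G' t)) ∧
      (∀ φ π : Peierls.Test n, ∃ u v : ℝ → Peierls.Test n, Peierls.IsCauchySolution m φ π u v) ∧
      ∀ (φ π : Peierls.Test n) (u v : ℝ → Peierls.Test n), Peierls.IsCauchySolution m φ π u v →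
        (∀ t x, u t x = Peierls.convFun (G t) π x + Peierls.convFun (G' t) φ x) ∧
        (∀ t s y, Peierls.bracket G G' u v t s y = -Peierls.shift (G (t - s)) y) ∧
        (∀ t s y, Peierls.bracketInitial G G' φ π t s y = -Peierls.shift (G (t - s)) y) ∧
        (∀ t s y, Peierls.star G G' u v t s y =
          Pi.single (M := fun _ => Peierls.Dist n) 0 (Peierls.ofFunction fun x => u t x * u s y) +
            Pi.single (M := fun _ => Peierls.Dist n) 1 (Peierls.bracket G G' u v t s y)) := by
  refine ⟨Peierls.green m, Peierls.green' m, Peierls.isGreenFunction_green,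
    fun D D' h => h.eq_green, fun t => ⟨⟨_, Peierls.isConvTranspose_green t⟩,
      ⟨_, Peierls.isConvTranspose_green' t⟩⟩, Peierls.exists_isCauchySolution,
    fun φ π u v h => ⟨h.apply_eq_convFun, Peierls.bracket_green u v,
      Peierls.bracketInitial_green φ π, Peierls.star_green h.toIsKleinGordon⟩⟩
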